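/- Let $M^3$ be a smooth $3$-manifold, $I\subset\mathbb R$ an interval containing $0$, $g_t$ ($t\in I$) a smooth family of Riemannian metrics on $M^3$ and $U_t$ a smooth family of vector fields with $g_t(U_t,U_t)=1$. Let $\mathcal G=-dt^2+g_t$ be the associated space-time metric on $I\times M^3$, with curvature ${}^{\mathcal G}R(A,B)=\nabla_A\nabla_B-\nabla_B\nabla_A-\nabla_{[A,B]}$. Write $\nabla^g$ and $\mathrm{Ricci}^g$ for the Levi-Civita connection and the Ricci tensor of $g=g_t$, put $\theta=g(U,\cdot)$, $\alpha\odot\beta=\tfrac12(\alpha\otimes\beta+\beta\otimes\alpha)$, $(\mathrm{sym}\,S)(A,B)=\tfrac12(S(A,B)+S(B,A))$, and $$\mathcal R=-\mathrm{Ricci}^g+\mathrm{sym}\,\mathcal G({}^{\mathcal G}R(\partial_t,\cdot)U,\cdot).$$ For local vector fields $X,Y$ such that $X,Y,U$ is an orthonormal frame of $(M^3,g_t)$, and $Z=X-iY$, let $\rho=g(\nabla^g_{\bar Z}U,Z)$ and let $\nu=g(U,\nabla^g_XX+\nabla^g_YY)=-\mathrm{Re}\,\rho$ be the mean curvature of the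 distribution $U^\perp$. Suppose that on $I\times M^3$ $$\text{(i)}\quad\frac{\partial U}{\partial t}=-\nabla^g_UU,$$ and that, wherever $\nu\neq0$, $$\text{(ii)}\quad\frac{\partial g}{\partial t}=-\frac4\nu\left\{\mathcal R-2\,\mathcal R(U,\cdot)\odot\theta+\mathcal R(U,U)\,\theta^2\right\}.$$ (a) Suppose that $U_0$ is tangent to a conformal foliation of $(M^3,g_0)$, i.e. there is a function $a$ with $(\mathcal L_{U_0}g_0)(X,Y)=a\,g_0(X,Y)$ for all vector fields $X,Y$ orthogonal to $U_0$, and that the complementary distribution $U_0^\perp$ is integrable, i.e. closed under Lie brackets. Let $t\in I$, $t\ge0$, be such that $\rho$ vanishes nowhere on $[0,t]\times M^3$, and let $M_t\subset M^3$ be the set of those $x$ for which the integral curve of $\partial_t+U$ ending at $(t,x)$ can be followed back to the initial slice $\{0\}\times M^3$. Then on $M_t$ the vector field $U_t$ is tangent to a conformal foliation with respect to $g_t$, and $U_t^\perp$ is integrable on $M_t$. In particular, both properties hold on all of $M^3$ if every integral curve can be followed back to the initial slice, that is, if $M_t=M^3$. (b) Every integral curve of the vector field $\partial_t+U$ in $I\times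 M^3$, defined on an open set of parameters and along which $\nu\ne0$, is a null geodesic of $\mathcal G$. -/

import Mathlib

open scoped Manifold ContDiff Topology
open Set

noncomputable section

namespace NullFlow

/-! ### Pseudo-Riemannian geometry in coordinates

A metric on an open part of a vector space `F` (the range of a chart) is a map
`G : F → F →L[ℝ] F →L[ℝ] ℝ`. -/

section Coordinates

variable {F : Type*} [NormedAddCommGroup F] [NormedSpace ℝ F]

/-- The Christoffel symbols `Γ(v, w)` of `G` at `p`:
`G(Γ(v, w), z) = (D_v G(w, z) + D_w G(v, z) - D_z G(v, w)) / 2` for all `z`. -/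
def christoffel (G : F → F →L[ℝ] F →L[ℝ] ℝ) (p v w : F) : F :=
  (G p).inverse ((1 / 2 : ℝ) •
    (fderiv ℝ G p v w + fderiv ℝ G p w v - ((fderiv ℝ G p).flip v).flip w))

/-- The Levi-Civita covariant derivative `∇_v W` at `p` of the vector field `W`. -/
def cov (G : F → F →L[ℝ] F →L[ℝ] ℝ) (W : F → F) (p v : F) : F :=
  fderiv ℝ W p v + christoffel G p v (W p)

/-- The curvature `R(v, w)z = ∇_v ∇_w z - ∇_w ∇_v z - ∇_[v, w] z` of `G` at `p`. -/
def curvature (G : F → F →L[ℝ] F →L[ℝ] ℝ) (p v w z : F) : F :=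
  fderiv ℝ (fun q => christoffel G q w z) p v - fderiv ℝ (fun q => christoffel G q v z) p w
    + christoffel G p v (christoffel G p w z) - christoffel G p w (christoffel G p v z)

theorem apply_christoffel (G : F → F →L[ℝ] F →L[ℝ] ℝ) (p v w z : F) (hG : (G p).IsInvertible) :
    G p (christoffel G p v w) z
      = (1 / 2) * (fderiv ℝ G p v w z + fderiv ℝ G p w v z - fderiv ℝ G p z v w) := by
  obtain ⟨e, he⟩ := hG
  simp [christoffel, ← he]

theorem inner_cov_self (G : F → F →L[ℝ] F →L[ℝ] ℝ) (W X : F → F) (p : F)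
    (hG : DifferentiableAt ℝ G p) (hW : DifferentiableAt ℝ W p) (hX : DifferentiableAt ℝ X p)
    (hsymm : ∀ q v w, G q v w = G q w v) (hinv : (G p).IsInvertible)
    (h : ∀ᶠ q in 𝓝 p, G q (W q) (X q) = 0) :
    G p (W p) (cov G X p (X p)) = - G p (cov G W p (X p)) (X p) := by
  have hd := ((hG.hasFDerivAt.clm_apply hW.hasFDerivAt).clm_apply hX.hasFDerivAt).congr_of_eventuallyEq
    (f₁ := fun _ => (0 : ℝ)) (h.mono fun q hq => hq.symm)
  have h0 := congrArg (fun L : F →L[ℝ] ℝ => L (X p)) (hd.unique (hasFDerivAt_const (0 : ℝ) p))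
  have hs : ∀ a v w : F, fderiv ℝ G p a v w = fderiv ℝ G p a w v := by
    intro a v w
    have h1 := (hG.hasFDerivAt.clm_apply (hasFDerivAt_const v p)).clm_apply (hasFDerivAt_const w p)
    have h2 := (hG.hasFDerivAt.clm_apply (hasFDerivAt_const w p)).clm_apply (hasFDerivAt_const v p)
    have h3 := h1.unique (h2.congr_of_eventuallyEq (.of_forall fun q => hsymm q v w))
    simpa using congrArg (fun L : F →L[ℝ] ℝ => L a) h3
  simp only [add_apply, ContinuousLinearMap.comp_apply,
    ContinuousLinearMap.flip_apply, zero_apply] at h0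
  simp only [cov, map_add, add_apply]
  rw [hsymm p (W p) (christoffel G p (X p) (X p)), apply_christoffel G p _ _ _ hinv,
    apply_christoffel G p _ _ _ hinv]
  have := hs (X p) (X p) (W p)
  linarith

end Coordinates

/-- The model space of a `3`-manifold. -/
abbrev E3 : Type := EuclideanSpace ℝ (Fin 3)

/-- The Ricci tensor: the trace of `z ↦ R(z, v)w`. -/
def ricci (g : E3 → E3 →L[ℝ] E3 →L[ℝ] ℝ) (y v w : E3) : ℝ :=
  ∑ i : Fin 3, (curvature g y (EuclideanSpace.single i 1) v w) i

/-- `X`, `Y` complete the unit vector `u` to an orthonormal basis with respect to `b`. -/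
structure IsComplementaryFrame (b : E3 →L[ℝ] E3 →L[ℝ] ℝ) (u X Y : E3) : Prop where
  norm_X : b X X = 1
  norm_Y : b Y Y = 1
  orth_XY : b X Y = 0
  orth_uX : b u X = 0
  orth_uY : b u Y = 0

/-- `ρ = g(∇_{Z̄} u, Z)`, with `Z = X - iY` and `g`, `∇` extended complex-linearly. -/
def rho (g : E3 → E3 →L[ℝ] E3 →L[ℝ] ℝ) (u : E3 → E3) (y X Y : E3) : ℂ :=
  ((g y (cov g u y X) X + g y (cov g u y Y) Y : ℝ) : ℂ)
    + ((g y (cov g u y Y) X - g y (cov g u y X) Y : ℝ) : ℂ) * Complex.I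

/-- The mean curvature `ν = g(u, ∇_X X + ∇_Y Y)` of the distribution `u^⊥`. For fields `X`
orthogonal to `u` one has `g(u, ∇_X X) = - g(∇_X u, X)` (see `inner_cov_self`), which only involves
the value of `X` at the point. -/
def nu (g : E3 → E3 →L[ℝ] E3 →L[ℝ] ℝ) (u : E3 → E3) (y X Y : E3) : ℝ :=
  -(g y (cov g u y X) X + g y (cov g u y Y) Y)

/-- The space-time metric `- dt² + g_t` in the coordinates `(t, y)`. -/
def spacetime (g : ℝ × E3 → E3 →L[ℝ] E3 →L[ℝ] ℝ) (p : ℝ × E3) :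
    (ℝ × E3) →L[ℝ] (ℝ × E3) →L[ℝ] ℝ :=
  (g p).bilinearComp (ContinuousLinearMap.snd ℝ ℝ E3) (ContinuousLinearMap.snd ℝ ℝ E3)
    - (ContinuousLinearMap.mul ℝ ℝ).bilinearComp
        (ContinuousLinearMap.fst ℝ ℝ E3) (ContinuousLinearMap.fst ℝ ℝ E3)

/-- The `2`-tensor `G(R(∂_t, v)U, w)`, with `R` the curvature of the space-time metric `G`. -/
def mixedCurvature (g : ℝ × E3 → E3 →L[ℝ] E3 →L[ℝ] ℝ) (u : ℝ × E3 → E3) (p : ℝ × E3)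
    (v w : E3) : ℝ :=
  spacetime g p (curvature (spacetime g) p (1, 0) (0, v) (0, u p)) (0, w)

/-- The symmetric tensor `𝓡 = - Ricci + sym G(R(∂_t, ·)U, ·)` on the slice of constant time. -/
def curvR (g : ℝ × E3 → E3 →L[ℝ] E3 →L[ℝ] ℝ) (u : ℝ × E3 → E3) (p : ℝ × E3) (v w : E3) : ℝ :=
  - ricci (fun y => g (p.1, y)) p.2 v w
    + (1 / 2) * (mixedCurvature g u p v w + mixedCurvature g u p w v)

/-- The tensor `𝓡 - 2 𝓡(U, ·) ⊙ θ + 𝓡(U, U) θ²`, with `θ = g(U, ·)` and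
`α ⊙ β = (α ⊗ β + β ⊗ α) / 2`. -/
def curvRPerp (g : ℝ × E3 → E3 →L[ℝ] E3 →L[ℝ] ℝ) (u : ℝ × E3 → E3) (p : ℝ × E3) (v w : E3) :
    ℝ :=
  curvR g u p v w
    - (curvR g u p (u p) v * g p (u p) w + curvR g u p (u p) w * g p (u p) v)
    + curvR g u p (u p) (u p) * (g p (u p) v * g p (u p) w)

/-! ### Evolving metrics and vector fields on a `3`-manifold -/

variable {M : Type*} [TopologicalSpace M] [ChartedSpace E3 M]

/-- The metrics `g_t` read in the chart `φ`, as a function of `(t, y)`. -/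
def metricIn (g : ℝ → Bundle.RiemannianMetric (fun x : M => TangentSpace (𝓡 3) x))
    (φ : OpenPartialHomeomorph M E3) (p : ℝ × E3) : E3 →L[ℝ] E3 →L[ℝ] ℝ :=
  let A : E3 →L[ℝ] E3 := mfderiv (𝓡 3) (𝓡 3) φ.symm p.2
  ContinuousLinearMap.bilinearComp
    (show E3 →L[ℝ] E3 →L[ℝ] ℝ from (g p.1).inner (φ.symm p.2)) A A

/-- The vector fields `U_t` read in the chart `φ`, as a function of `(t, y)`. -/
def fieldIn (U : ℝ → (x : M) → TangentSpace (𝓡 3) x)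
    (φ : OpenPartialHomeomorph M E3) (p : ℝ × E3) : E3 :=
  mfderiv (𝓡 3) (𝓡 3) φ (φ.symm p.2) (U p.1 (φ.symm p.2))

/-- A smooth evolving triple `(M, g_t, U_t)`, `t ∈ I`, with `U_t` a unit vector field. At an end
point of `I` that belongs to `I`, smoothness means that `g` and `U` are smooth beyond this point;
what they are at times outside `I` plays no other role. -/
structure IsEvolvingTriple (I : Set ℝ)
    (g : ℝ → Bundle.RiemannianMetric (fun x : M => TangentSpace (𝓡 3) x))
    (U : ℝ → (x : M) → TangentSpace (𝓡 3) x) : Prop where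
  smooth_metric : ∀ φ ∈ IsManifold.maximalAtlas (𝓡 3) ∞ M, ∀ t ∈ I, ∀ y ∈ φ.target,
    ContDiffAt ℝ ∞ (metricIn g φ) (t, y)
  smooth_field : ∀ φ ∈ IsManifold.maximalAtlas (𝓡 3) ∞ M, ∀ t ∈ I, ∀ y ∈ φ.target,
    ContDiffAt ℝ ∞ (fieldIn U φ) (t, y)
  unit : ∀ t ∈ I, ∀ x : M, (g t).inner x (U t x) (U t x) = 1

/-- `ρ` is non-zero at `(t, x)`. The value of `ρ` does not depend on the chart, and a change of the
complementary frame changes it at most into its complex conjugate. -/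
def RhoNeZero (g : ℝ → Bundle.RiemannianMetric (fun x : M => TangentSpace (𝓡 3) x))
    (U : ℝ → (x : M) → TangentSpace (𝓡 3) x) (t : ℝ) (x : M) : Prop :=
  ∀ φ ∈ IsManifold.maximalAtlas (𝓡 3) ∞ M, x ∈ φ.source → ∀ X Y : E3,
    IsComplementaryFrame (metricIn g φ (t, φ x)) (fieldIn U φ (t, φ x)) X Y →
      rho (fun y => metricIn g φ (t, y)) (fun y => fieldIn U φ (t, y)) (φ x) X Y ≠ 0

/-- The mean curvature `ν` of `U_t^⊥` is non-zero at `(t, x)`. Its value depends neither on the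
chart nor on the complementary frame. -/
def NuNeZero (g : ℝ → Bundle.RiemannianMetric (fun x : M => TangentSpace (𝓡 3) x))
    (U : ℝ → (x : M) → TangentSpace (𝓡 3) x) (t : ℝ) (x : M) : Prop :=
  ∀ φ ∈ IsManifold.maximalAtlas (𝓡 3) ∞ M, x ∈ φ.source → ∀ X Y : E3,
    IsComplementaryFrame (metricIn g φ (t, φ x)) (fieldIn U φ (t, φ x)) X Y →
      nu (fun y => metricIn g φ (t, y)) (fun y => fieldIn U φ (t, y)) (φ x) X Y ≠ 0

/-- The evolution equations, in all charts:
`∂U/∂t = - ∇_U U` and `∂g/∂t = - (4 / ν) {𝓡 - 2 𝓡(U, ·) ⊙ θ + 𝓡(U, U) θ²}`.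
The second one is imposed wherever it makes sense, that is, wherever `ν ≠ 0`. -/
structure IsModifiedRicciFlow (I : Set ℝ)
    (g : ℝ → Bundle.RiemannianMetric (fun x : M => TangentSpace (𝓡 3) x))
    (U : ℝ → (x : M) → TangentSpace (𝓡 3) x) : Prop where
  field_eq : ∀ φ ∈ IsManifold.maximalAtlas (𝓡 3) ∞ M, ∀ t ∈ I, ∀ y ∈ φ.target,
    deriv (fun s => fieldIn U φ (s, y)) t
      = - cov (fun z => metricIn g φ (t, z)) (fun z => fieldIn U φ (t, z)) y (fieldIn U φ (t, y))
  metric_eq : ∀ φ ∈ IsManifold.maximalAtlas (𝓡 3) ∞ M, ∀ t ∈ I, ∀ y ∈ φ.target, ∀ X Y : E3,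
    IsComplementaryFrame (metricIn g φ (t, y)) (fieldIn U φ (t, y)) X Y →
    nu (fun z => metricIn g φ (t, z)) (fun z => fieldIn U φ (t, z)) y X Y ≠ 0 →
    ∀ v w : E3, deriv (fun s => metricIn g φ (s, y) v w) t
      = - (4 / nu (fun z => metricIn g φ (t, z)) (fun z => fieldIn U φ (t, z)) y X Y)
          * curvRPerp (metricIn g φ) (fieldIn U φ) (t, y) v w

/-- `X` is a smooth vector field near `x`, orthogonal to `U`. -/
def IsHorizontalNear (g : Bundle.RiemannianMetric (fun x : M => TangentSpace (𝓡 3) x))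
    (U X : (x : M) → TangentSpace (𝓡 3) x) (x : M) [IsManifold (𝓡 3) ∞ M] : Prop :=
  ContMDiffAt (𝓡 3) (𝓡 3).tangent ∞ (fun z => (⟨z, X z⟩ : TangentBundle (𝓡 3) M)) x ∧
    ∀ᶠ z in 𝓝 x, g.inner z (U z) (X z) = 0

/-- The Lie derivative `(L_U g)(X, Y) = U(g(X, Y)) - g([U, X], Y) - g(X, [U, Y])` at `x`. -/
def lieDerivMetric (g : Bundle.RiemannianMetric (fun x : M => TangentSpace (𝓡 3) x))
    (U X Y : (x : M) → TangentSpace (𝓡 3) x) (x : M) : ℝ :=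
  (show ℝ from mfderiv (𝓡 3) 𝓘(ℝ, ℝ) (fun z => g.inner z (X z) (Y z)) x (U x))
    - g.inner x (VectorField.mlieBracket (𝓡 3) U X x) (Y x)
    - g.inner x (X x) (VectorField.mlieBracket (𝓡 3) U Y x)

/-- On the set `V` the vector field `U` is tangent to a conformal foliation of `(M, g)`: there is a
function `a` with `(L_U g)(X, Y) = a g(X, Y)` for all `X`, `Y` orthogonal to `U`. -/
def IsConformalFoliationOn (g : Bundle.RiemannianMetric (fun x : M => TangentSpace (𝓡 3) x))
    (U : (x : M) → TangentSpace (𝓡 3) x) (V : Set M) [IsManifold (𝓡 3) ∞ M] : Prop :=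
  ∃ a : M → ℝ, ∀ x ∈ V, ∀ X Y : (x : M) → TangentSpace (𝓡 3) x,
    IsHorizontalNear g U X x → IsHorizontalNear g U Y x →
      lieDerivMetric g U X Y x = a x * g.inner x (X x) (Y x)

/-- On the set `V` the distribution `U^⊥` is integrable: it is closed under Lie brackets. -/
def IsIntegrableComplementOn
    (g : Bundle.RiemannianMetric (fun x : M => TangentSpace (𝓡 3) x))
    (U : (x : M) → TangentSpace (𝓡 3) x) (V : Set M) [IsManifold (𝓡 3) ∞ M] : Prop :=
  ∀ x ∈ V, ∀ X Y : (x : M) → TangentSpace (𝓡 3) x,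
    IsHorizontalNear g U X x → IsHorizontalNear g U Y x →
      g.inner x (U x) (VectorField.mlieBracket (𝓡 3) X Y x) = 0

/-- The vector field `∂_t + U` on `ℝ × M`. -/
def nullField (U : ℝ → (x : M) → TangentSpace (𝓡 3) x) (p : ℝ × M) :
    TangentSpace (𝓘(ℝ, ℝ).prod (𝓡 3)) p :=
  ((1 : ℝ), (U p.1 p.2 : E3))

/-- The points `x` such that the integral curve of `∂_t + U` that ends at `(t, x)` can be followed
back to the initial slice `{0} × M`. -/
def reached (U : ℝ → (x : M) → TangentSpace (𝓡 3) x) (t : ℝ) : Set M :=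
  {x | ∃ γ : ℝ → ℝ × M, IsMIntegralCurveOn (I := 𝓘(ℝ, ℝ).prod (𝓡 3)) γ (nullField U) (Icc 0 t) ∧
    (γ 0).1 = 0 ∧ γ t = (t, x)}

/-- On the open set `J` the curve `γ` in `ℝ × M` is a null geodesic of `- dt² + g_t`: in charts
`c'' + Γ(c', c') = 0` and `c'` is null and non-zero. -/
def IsNullGeodesicOn (g : ℝ → Bundle.RiemannianMetric (fun x : M => TangentSpace (𝓡 3) x))
    (γ : ℝ → ℝ × M) (J : Set ℝ) : Prop :=
  ContinuousOn γ J ∧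
  ∀ φ ∈ IsManifold.maximalAtlas (𝓡 3) ∞ M, ∀ s ∈ J, (γ s).2 ∈ φ.source →
    let c : ℝ → ℝ × E3 := fun r => ((γ r).1, φ (γ r).2)
    ContDiffAt ℝ 2 c s ∧
      deriv (deriv c) s
        + christoffel (spacetime (metricIn g φ)) (c s) (deriv c s) (deriv c s) = 0 ∧
      spacetime (metricIn g φ) (c s) (deriv c s) (deriv c s) = 0 ∧ deriv c s ≠ 0

end NullFlow

end

noncomputable section

set_option maxSynthPendingDepth 3

namespace NullFlow

/-! ### Second-order calculus of metrics: Christoffel symbols and the lowered curvature tensor. -/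

section Metric

variable {F : Type*} [NormedAddCommGroup F] [NormedSpace ℝ F]
variable {H : Type*} [NormedAddCommGroup H] [NormedSpace ℝ H]

/-! Write B(v, w) = g(∇_v U, w) (`shape`), h = ∂g/∂t and W = ∂_t + U. For X, Y orthogonal to U one
has (L_U g)(X, Y) = B(X, Y) + B(Y, X) and g(U, [X, Y]) = B(Y, X) - B(X, Y). So conformality together
with integrability says that B is a multiple of g on the plane U^⊥ (`IsUmbilicAt`), that is, that
the sum of squares of its three remaining components vanishes (`defect`).

The tensor in braces in (ii) is killed by U, so h(U, ·) = 0 wherever ν ≠ 0; and (i) says that U is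
parallel along W. With these two facts the derivative of B along W (`fderiv_shape`) is, up to terms
quadratic in B or of the form h·B, equal to -g(R(X, U)U, Y) + (∇_U h)(X, Y)/2. In dimension three
Ricci and R(·, U)U differ on U^⊥ by a multiple of g (`ricci_horizontal`), and the Codazzi equation
turns the mixed space-time curvature into (∇_U h)/2 plus terms h·B (`mixedCurvature_sym`). Hence 𝓡
contains exactly the second-order part of the evolution of B, modulo multiples of g. Since tr B = -ν
on U^⊥, equation (ii) there reads (tr B) h = 4𝓡, so this part can be traded for terms h·B. The
constant 4 makes the trace-free part of h cancel whenever B is a multiple of g. What is left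
(`defect_evolution_algebra`) is a quadratic form, with locally bounded coefficients, in the three
components that `defect` measures. Gronwall's inequality then keeps a vanishing defect zero
(`eventually_isUmbilicAt`).

At an umbilic point ρ is real and equals -ν, so ρ ≠ 0 supplies the ν ≠ 0 needed to continue. Along
an integral curve of W the good times are closed, contain 0 and are open to the right, hence fill
[0, t] (`isConformalIntegrableAt_of_integralCurve`).

For (b), h(U, ·) = 0 reduces the space-time acceleration of W to the slice-covariant derivative of U
along W, which vanishes by (i) (`geodesic_eq`). The curve is null because U is a unit field. -/

theorem fderiv_bilin_apply {G : H → F →L[ℝ] F →L[ℝ] ℝ} {p : H} (hG : DifferentiableAt ℝ G p)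
    (a : H) (v w : F) : fderiv ℝ (fun q => G q v w) p a = fderiv ℝ G p a v w := by
  have h := (hG.hasFDerivAt.clm_apply (hasFDerivAt_const v p)).clm_apply (hasFDerivAt_const w p)
  rw [h.fderiv]
  simp

theorem fderiv_bilin_symm {G : H → F →L[ℝ] F →L[ℝ] ℝ} {p : H} (hG : DifferentiableAt ℝ G p)
    (hsymm : ∀ q v w, G q v w = G q w v) (a : H) (v w : F) :
    fderiv ℝ G p a v w = fderiv ℝ G p a w v := by
  rw [← fderiv_bilin_apply hG, ← fderiv_bilin_apply hG]
  simp only [hsymm _ v w]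

theorem fderiv_fderiv_bilin_apply {G : H → F →L[ℝ] F →L[ℝ] ℝ} {p : H}
    (hG : ContDiffAt ℝ 2 G p) (a b : H) (v w : F) :
    fderiv ℝ (fun q => fderiv ℝ G q b v w) p a = fderiv ℝ (fderiv ℝ G) p a b v w := by
  have hd : DifferentiableAt ℝ (fderiv ℝ G) p :=
    (hG.fderiv_right (m := 1) (by norm_num)).differentiableAt (by norm_num)
  have h := ((hd.hasFDerivAt.clm_apply (hasFDerivAt_const b p)).clm_apply
    (hasFDerivAt_const v p)).clm_apply (hasFDerivAt_const w p)
  rw [h.fderiv]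
  simp

theorem fderiv_fderiv_bilin_symm {G : H → F →L[ℝ] F →L[ℝ] ℝ} {p : H}
    (hG : ContDiffAt ℝ 2 G p) (hsymm : ∀ q v w, G q v w = G q w v) (a b : H) (v w : F) :
    fderiv ℝ (fderiv ℝ G) p a b v w = fderiv ℝ (fderiv ℝ G) p a b w v := by
  rw [← fderiv_fderiv_bilin_apply hG, ← fderiv_fderiv_bilin_apply hG]
  have he : (fun q => fderiv ℝ G q b v w) =ᶠ[𝓝 p] fun q => fderiv ℝ G q b w v := by
    filter_upwards [hG.eventually (by simp)] with q hq
    exact fderiv_bilin_symm (hq.differentiableAt (by norm_num)) hsymm b v w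
  rw [he.fderiv_eq]

theorem fderiv_fderiv_swap {E : Type*} [NormedAddCommGroup E] [NormedSpace ℝ E] {f : H → E} {p : H}
    (hf : ContDiffAt ℝ 2 f p) (a b : H) :
    fderiv ℝ (fderiv ℝ f) p a b = fderiv ℝ (fderiv ℝ f) p b a :=
  hf.isSymmSndFDerivAt (by simp) a b

theorem differentiableAt_fderiv {E : Type*} [NormedAddCommGroup E] [NormedSpace ℝ E] {f : H → E}
    {p : H} (hf : ContDiffAt ℝ 2 f p) : DifferentiableAt ℝ (fderiv ℝ f) p :=
  (hf.fderiv_right (m := 1) (by norm_num)).differentiableAt (by norm_num)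

theorem christoffel_add_left (G : F → F →L[ℝ] F →L[ℝ] ℝ) (p v v' w : F) :
    christoffel G p (v + v') w = christoffel G p v w + christoffel G p v' w := by
  rw [christoffel, christoffel, christoffel, ← map_add, ← smul_add]
  congr 2
  ext z
  simp
  ring

theorem christoffel_smul_left (G : F → F →L[ℝ] F →L[ℝ] ℝ) (p : F) (c : ℝ) (v w : F) :
    christoffel G p (c • v) w = c • christoffel G p v w := by
  rw [christoffel, christoffel, ← map_smul, smul_comm]
  congr 2
  ext z
  simp
  ring

theorem injective_of_isInvertible {A : F →L[ℝ] F →L[ℝ] ℝ} (hA : A.IsInvertible) {v w : F}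
    (h : ∀ z, A v z = A w z) : v = w := by
  obtain ⟨e, rfl⟩ := hA
  exact e.injective (ContinuousLinearMap.ext h)

theorem eventually_isInvertible [CompleteSpace F] {T : Type*} [TopologicalSpace T] {G : T → F →L[ℝ] F →L[ℝ] ℝ} {p : T}
    (hG : ContinuousAt G p) (hinv : (G p).IsInvertible) : ∀ᶠ q in 𝓝 p, (G q).IsInvertible := by
  obtain ⟨e, he⟩ := hinv
  have := ContinuousLinearEquiv.nhds e
  rw [he] at this
  filter_upwards [hG this] with q hq
  obtain ⟨e', he'⟩ := hq
  exact ⟨e', he'⟩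

theorem differentiableAt_christoffel [CompleteSpace F] {G : F → F →L[ℝ] F →L[ℝ] ℝ} {p : F}
    (hG : ContDiffAt ℝ 2 G p) (hinv : (G p).IsInvertible) (v w : F) :
    DifferentiableAt ℝ (fun q => christoffel G q v w) p := by
  obtain ⟨e, he⟩ := hinv
  have h1 : DifferentiableAt ℝ (fun q => (G q).inverse) p := by
    have h := (contDiffAt_map_inverse (n := 1) e).differentiableAt (by norm_num)
    rw [he] at h
    exact h.comp p (hG.differentiableAt (by norm_num))
  have h2 := differentiableAt_fderiv hG
  have h3 : DifferentiableAt ℝ (fun q => ((fderiv ℝ G q).flip v).flip w) p := by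
    have h4 : DifferentiableAt ℝ (fun q => (fderiv ℝ G q).flip) p :=
      (ContinuousLinearMap.flipₗᵢ ℝ F F (F →L[ℝ] ℝ)).differentiableAt.comp p h2
    have h5 : DifferentiableAt ℝ (fun q => ((fderiv ℝ G q).flip v).flip) p :=
      (ContinuousLinearMap.flipₗᵢ ℝ F F ℝ).differentiableAt.comp p
        (h4.clm_apply (differentiableAt_const v))
    exact h5.clm_apply (differentiableAt_const w)
  refine h1.clm_apply ((DifferentiableAt.fun_sub (DifferentiableAt.fun_add ?_ ?_) h3).fun_const_smul _)
  · exact (h2.clm_apply (differentiableAt_const _)).clm_apply (differentiableAt_const _)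
  · exact (h2.clm_apply (differentiableAt_const _)).clm_apply (differentiableAt_const _)

/-- Metric compatibility of the Christoffel symbols. -/
theorem fderiv_metric_eq {G : F → F →L[ℝ] F →L[ℝ] ℝ} {p : F}
    (hG : DifferentiableAt ℝ G p) (hsymm : ∀ q v w, G q v w = G q w v)
    (hinv : (G p).IsInvertible) (a v w : F) :
    fderiv ℝ G p a v w = G p (christoffel G p a v) w + G p (christoffel G p a w) v := by
  rw [apply_christoffel G p _ _ _ hinv, apply_christoffel G p _ _ _ hinv]
  have := fderiv_bilin_symm hG hsymm a v w
  have := fderiv_bilin_symm hG hsymm v a w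
  have := fderiv_bilin_symm hG hsymm w a v
  linarith

/-- Product rule applied to the defining identity of G(Γ(w, z), q), which holds near p. Pairing with
G avoids differentiating its inverse. -/
theorem apply_fderiv_christoffel [CompleteSpace F] {G : F → F →L[ℝ] F →L[ℝ] ℝ} {p : F}
    (hG : ContDiffAt ℝ 2 G p) (hinv : (G p).IsInvertible) (v w z q : F) :
    G p (fderiv ℝ (fun r => christoffel G r w z) p v) q
      = (1 / 2) * (fderiv ℝ (fderiv ℝ G) p v w z q + fderiv ℝ (fderiv ℝ G) p v z w q
        - fderiv ℝ (fderiv ℝ G) p v q w z) - fderiv ℝ G p v (christoffel G p w z) q := by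
  have hd := hG.differentiableAt (by norm_num)
  have h1 := (hd.hasFDerivAt.clm_apply
    (differentiableAt_christoffel hG hinv w z).hasFDerivAt).clm_apply (hasFDerivAt_const q p)
  have h2 := differentiableAt_fderiv hG
  have h3 (a b c : F) := ((h2.hasFDerivAt.clm_apply (hasFDerivAt_const a p)).clm_apply
    (hasFDerivAt_const b p)).clm_apply (hasFDerivAt_const c p)
  have h4 := (((h3 w z q).add (h3 z w q)).sub (h3 q w z)).const_mul (1 / 2)
  have he : (fun r => G r (christoffel G r w z) q) =ᶠ[𝓝 p] fun r =>
      (1 / 2) * (fderiv ℝ G r w z q + fderiv ℝ G r z w q - fderiv ℝ G r q w z) := by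
    filter_upwards [eventually_isInvertible hd.continuousAt hinv] with r hr
    exact apply_christoffel G r _ _ _ hr
  have h5 := congrArg (fun L : F →L[ℝ] ℝ => L v) (h1.unique (h4.congr_of_eventuallyEq he))
  simp at h5 ⊢
  linarith

/-- The curvature tensor with all indices lowered. -/
theorem apply_curvature [CompleteSpace F] {G : F → F →L[ℝ] F →L[ℝ] ℝ} {p : F}
    (hG : ContDiffAt ℝ 2 G p) (hsymm : ∀ q v w, G q v w = G q w v) (hinv : (G p).IsInvertible)
    (v w z q : F) :
    G p (curvature G p v w z) q
      = (1 / 2) * (fderiv ℝ (fderiv ℝ G) p v z w q - fderiv ℝ (fderiv ℝ G) p v q w z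
          - fderiv ℝ (fderiv ℝ G) p w z v q + fderiv ℝ (fderiv ℝ G) p w q v z)
        - G p (christoffel G p w z) (christoffel G p v q)
        + G p (christoffel G p v z) (christoffel G p w q) := by
  have hd := hG.differentiableAt (by norm_num)
  simp only [curvature, map_add, map_sub, add_apply, sub_apply]
  -- Metric compatibility splits D_v G(Γ(w, z), q) into two products. One cancels the term Γ(v, Γ(w,
  -- z)) of the curvature, the other is the quadratic term that remains.
  rw [apply_fderiv_christoffel hG hinv, apply_fderiv_christoffel hG hinv,
    fderiv_metric_eq hd hsymm hinv v, fderiv_metric_eq hd hsymm hinv w,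
    fderiv_fderiv_swap hG v w, hsymm p (christoffel G p v q), hsymm p (christoffel G p w q)]
  ring

end Metric

end NullFlow

/-! ### The pointwise identity behind the evolution of g(∇u, ·). -/

namespace NullFlow

/-- The evolution of the tensor `g(∇_v u, w)` along `∂_t + u`, expressed in the `2`-jets of `g` and
`u` at a point: `h` is the time derivative of `g`, a final `1` denotes a further spatial
derivative. -/
theorem shape_evolution_jet {E : Type*} [NormedAddCommGroup E] [NormedSpace ℝ E]
    (g0 h : E →L[ℝ] E →L[ℝ] ℝ) (g1 h1 : E →L[ℝ] E →L[ℝ] E →L[ℝ] ℝ)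
    (g2 : E →L[ℝ] E →L[ℝ] E →L[ℝ] E →L[ℝ] ℝ) (u uT : E) (u1 uT1 : E →L[ℝ] E)
    (u2 : E →L[ℝ] E →L[ℝ] E) (Γ : E → E → E)
    (s0 : ∀ a b, g0 a b = g0 b a) (sh : ∀ a b, h a b = h b a)
    (s1 : ∀ a b c, g1 a b c = g1 a c b) (sh1 : ∀ a b c, h1 a b c = h1 a c b)
    (s2 : ∀ a b c d, g2 a b c d = g2 a b d c) (c2 : ∀ a b, g2 a b = g2 b a)
    (su : ∀ a b, u2 a b = u2 b a)
    (sΓ : ∀ a b, Γ a b = Γ b a)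
    (hΓ : ∀ a b c, g0 (Γ a b) c = (1 / 2) * (g1 a b c + g1 b a c - g1 c a b))
    (hu1 : ∀ v w, h1 v u w + h (u1 v) w = 0)
    (huT : uT = - (u1 u + Γ u u))
    (huT1 : ∀ v w, g0 (uT1 v) w + g1 v uT w
      = - (g0 (u2 v u) w + g0 (u1 (u1 v)) w + g1 v (u1 u) w)
        - (g2 v u u w + g1 (u1 v) u w + g1 u (u1 v) w - (1 / 2) * g2 v w u u - g1 w (u1 v) u))
    (v w : E) :
    h (u1 v) w + g1 u (u1 v) w + g0 (uT1 v) w + g0 (u2 u v) w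
      + (1 / 2) * (h1 v u w + g2 u v u w + g1 v (uT + u1 u) w + h1 u v w + g2 u u v w
        + g1 (uT + u1 u) v w - h1 w v u - g2 u w v u - g1 w v (uT + u1 u))
    = - g0 (u1 (u1 v + Γ v u) + Γ (u1 v + Γ v u) u) w
      - ((1 / 2) * (g2 v u u w - g2 v w u u - g2 u u v w + g2 u w v u)
        - g0 (Γ u u) (Γ v w) + g0 (Γ v u) (Γ u w))
      + (1 / 2) * (h1 u v w - h (Γ u v) w - h v (Γ u w))
      + (1 / 2) * h (u1 v + Γ v u) w + (1 / 2) * h v (u1 w + Γ w u)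
      + g0 (u1 (Γ u v) + Γ (Γ u v) u) w + g0 (u1 v + Γ v u) (Γ u w) := by
  have e1 := huT1 v w
  -- The field equation eliminates the time derivative of u, here and in its differentiated form.
  have e2 : uT + u1 u = - Γ u u := by rw [huT]; abel
  have e3 : uT = - Γ u u - u1 u := by rw [huT]; abel
  rw [e2]
  rw [e3] at e1
  have q1 := hu1 v w
  have q2 := hu1 w v
  rw [sΓ v u, sΓ w u, s0 (Γ u u) (Γ v w), c2 v u] at *
  simp only [map_add, map_neg, map_sub, add_apply, neg_apply, sub_apply] at e1 ⊢
  -- Only those lowered Christoffel symbols are expanded whose first derivatives of g have no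
  -- counterpart otherwise. Together with the symmetries below this leaves an identity linear in the
  -- jet terms.
  have a1 := hΓ (u1 v) u w
  have a2 := hΓ v w (Γ u u)
  have a3 := hΓ u w (u1 v)
  have a4 := hΓ (Γ u v) u w
  have a5 : g0 (Γ (u1 v + Γ u v) u) w = g0 (Γ (u1 v) u) w + g0 (Γ (Γ u v) u) w := by
    simp only [hΓ, map_add, add_apply]; ring
  have a6 := s0 (u1 v) (Γ u w)
  have a7 := su v u
  rw [a7] at e1
  rw [a5, a6]
  have a8 := s1 v (Γ u u) w
  have a9 := s1 w (Γ u u) v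
  have a10 := s1 w (u1 v) u
  have a11 := s2 u w v u
  have a12 := s1 w v (Γ u u)
  have a13 := s2 u v u w
  have a14 := sh1 w u v
  have a15 := sh (u1 w) v
  have a16 := s1 (u1 v) u w
  have a17 := s1 u w (u1 v)
  linarith

end NullFlow

/-! ### Restriction to slices of constant time, and the space-time metric. -/

namespace NullFlow

section Slices

variable {E : Type*} [NormedAddCommGroup E] [NormedSpace ℝ E]
variable {V : Type*} [NormedAddCommGroup V] [NormedSpace ℝ V]

theorem fderiv_slice {f : ℝ × E → V} {p : ℝ × E} (hf : DifferentiableAt ℝ f p) :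
    fderiv ℝ (fun z => f (p.1, z)) p.2 = (fderiv ℝ f p).comp (ContinuousLinearMap.inr ℝ ℝ E) :=
  ((show HasFDerivAt f (fderiv ℝ f p) (p.1, p.2) from hf.hasFDerivAt).comp p.2
    (hasFDerivAt_prodMk_right p.1 p.2)).fderiv

theorem fderiv_slice_apply {f : ℝ × E → V} {p : ℝ × E} (hf : DifferentiableAt ℝ f p) (v : E) :
    fderiv ℝ (fun z => f (p.1, z)) p.2 v = fderiv ℝ f p (0, v) := by
  rw [fderiv_slice hf]; simp

theorem deriv_slice {f : ℝ × E → V} {p : ℝ × E} (hf : DifferentiableAt ℝ f p) :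
    deriv (fun s => f (s, p.2)) p.1 = fderiv ℝ f p (1, 0) := by
  have h := (show HasFDerivAt f (fderiv ℝ f p) (p.1, p.2) from hf.hasFDerivAt).comp p.1
    (hasFDerivAt_prodMk_left (𝕜 := ℝ) p.1 p.2)
  have h' := h.hasDerivAt.deriv
  simp only [ContinuousLinearMap.comp_apply, ContinuousLinearMap.inl_apply] at h'
  exact h'

theorem tendsto_slice {E : Type*} [TopologicalSpace E] (p : ℝ × E) : Filter.Tendsto (fun z => (p.1, z)) (𝓝 p.2) (𝓝 p) := by
  have h : Continuous fun z : E => (p.1, z) := by fun_prop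
  exact h.continuousAt.tendsto

theorem contDiffAt_slice {n : WithTop ℕ∞} {f : ℝ × E → V} {p : ℝ × E} (hf : ContDiffAt ℝ n f p) :
    ContDiffAt ℝ n (fun z => f (p.1, z)) p.2 := by
  have h : ContDiffAt ℝ n (fun z : E => (p.1, z)) p.2 := contDiffAt_const.prodMk contDiffAt_id
  exact ContDiffAt.comp p.2 (show ContDiffAt ℝ n f (p.1, p.2) from hf) h

theorem fderiv_fderiv_slice {f : ℝ × E → V} {p : ℝ × E} (hf : ContDiffAt ℝ 2 f p) (v w : E) :
    fderiv ℝ (fderiv ℝ fun z => f (p.1, z)) p.2 v w = fderiv ℝ (fderiv ℝ f) p (0, v) (0, w) := by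
  have he : (fderiv ℝ fun z => f (p.1, z)) =ᶠ[𝓝 p.2]
      fun z => (fderiv ℝ f (p.1, z)).comp (ContinuousLinearMap.inr ℝ ℝ E) := by
    filter_upwards [(tendsto_slice p).eventually (hf.eventually (by simp))] with z hz
    exact fderiv_slice (p := (p.1, z)) (hz.differentiableAt (by norm_num))
  have h2 : HasFDerivAt (fun z => fderiv ℝ f (p.1, z))
      ((fderiv ℝ (fderiv ℝ f) p).comp (ContinuousLinearMap.inr ℝ ℝ E)) p.2 :=
    (show HasFDerivAt (fderiv ℝ f) (fderiv ℝ (fderiv ℝ f) p) (p.1, p.2) from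
      (differentiableAt_fderiv hf).hasFDerivAt).comp p.2 (hasFDerivAt_prodMk_right p.1 p.2)
  rw [he.fderiv_eq, (h2.clm_comp (hasFDerivAt_const (ContinuousLinearMap.inr ℝ ℝ E) p.2)).fderiv]
  simp

end Slices

variable {g : ℝ × E3 → E3 →L[ℝ] E3 →L[ℝ] ℝ} {u : ℝ × E3 → E3} {p : ℝ × E3}

/-- The Christoffel symbols of the metric on the slice of constant time through `p`. -/
def sliceChristoffel (g : ℝ × E3 → E3 →L[ℝ] E3 →L[ℝ] ℝ) (p : ℝ × E3) (v w : E3) : E3 :=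
  christoffel (fun z => g (p.1, z)) p.2 v w

/-- The covariant derivative of `u` within the slice of constant time through `p`. -/
def sliceCov (g : ℝ × E3 → E3 →L[ℝ] E3 →L[ℝ] ℝ) (u : ℝ × E3 → E3) (p : ℝ × E3) (v : E3) : E3 :=
  cov (fun z => g (p.1, z)) (fun z => u (p.1, z)) p.2 v

/-- The tensor `g(∇_v u, w)` on the slices of constant time. -/
def shape (g : ℝ × E3 → E3 →L[ℝ] E3 →L[ℝ] ℝ) (u : ℝ × E3 → E3) (p : ℝ × E3) (v w : E3) : ℝ :=
  g p (sliceCov g u p v) w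

theorem sliceCov_eq (hu : DifferentiableAt ℝ u p) (v : E3) :
    sliceCov g u p v = fderiv ℝ u p (0, v) + sliceChristoffel g p v (u p) := by
  rw [sliceCov, cov, fderiv_slice_apply hu]; rfl

theorem apply_sliceChristoffel (hg : DifferentiableAt ℝ g p) (hinv : (g p).IsInvertible)
    (v w z : E3) :
    g p (sliceChristoffel g p v w) z
      = (1 / 2) * (fderiv ℝ g p (0, v) w z + fderiv ℝ g p (0, w) v z - fderiv ℝ g p (0, z) v w) := by
  have h := apply_christoffel (fun z => g (p.1, z)) p.2 v w z hinv
  rwa [fderiv_slice_apply hg, fderiv_slice_apply hg, fderiv_slice_apply hg] at h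

theorem sliceChristoffel_comm (hg : DifferentiableAt ℝ g p) (hinv : (g p).IsInvertible)
    (hsymm : ∀ q v w, g q v w = g q w v) (v w : E3) :
    sliceChristoffel g p v w = sliceChristoffel g p w v := by
  apply injective_of_isInvertible hinv
  intro z
  rw [apply_sliceChristoffel hg hinv, apply_sliceChristoffel hg hinv,
    fderiv_bilin_symm hg hsymm (0, z) v w]
  ring

/-- A formula free of Christoffel symbols, hence of the inverse metric; this is the form in which
`shape` gets differentiated. -/
theorem shape_eq (hg : DifferentiableAt ℝ g p) (hu : DifferentiableAt ℝ u p)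
    (hinv : (g p).IsInvertible) (v w : E3) :
    shape g u p v w = g p (fderiv ℝ u p (0, v)) w
      + (1 / 2) * (fderiv ℝ g p (0, v) (u p) w + fderiv ℝ g p (0, u p) v w
        - fderiv ℝ g p (0, w) v (u p)) := by
  rw [shape, sliceCov_eq hu, map_add, add_apply, apply_sliceChristoffel hg hinv]

theorem apply_slice_curvature (hg : ContDiffAt ℝ 2 g p) (hinv : (g p).IsInvertible)
    (hsymm : ∀ q v w, g q v w = g q w v) (v w z q : E3) :
    g p (curvature (fun z => g (p.1, z)) p.2 v w z) q
      = (1 / 2) * (fderiv ℝ (fderiv ℝ g) p (0, v) (0, z) w q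
          - fderiv ℝ (fderiv ℝ g) p (0, v) (0, q) w z
          - fderiv ℝ (fderiv ℝ g) p (0, w) (0, z) v q
          + fderiv ℝ (fderiv ℝ g) p (0, w) (0, q) v z)
        - g p (sliceChristoffel g p w z) (sliceChristoffel g p v q)
        + g p (sliceChristoffel g p v z) (sliceChristoffel g p w q) := by
  have h := apply_curvature (contDiffAt_slice hg) (fun z => hsymm (p.1, z)) hinv v w z q
  simp only [fderiv_fderiv_slice hg] at h
  exact h

/-! ### The space-time metric -/

theorem spacetime_apply (g : ℝ × E3 → E3 →L[ℝ] E3 →L[ℝ] ℝ) (p a b : ℝ × E3) :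
    spacetime g p a b = g p a.2 b.2 - a.1 * b.1 := by
  simp [spacetime]

theorem contDiffAt_bilinearComp {E F H : Type*} [NormedAddCommGroup E] [NormedSpace ℝ E]
    [NormedAddCommGroup F] [NormedSpace ℝ F] [NormedAddCommGroup H] [NormedSpace ℝ H]
    {n : WithTop ℕ∞} {G : H → F →L[ℝ] F →L[ℝ] ℝ} {q : H} (hG : ContDiffAt ℝ n G q)
    (A : E →L[ℝ] F) : ContDiffAt ℝ n (fun r => (G r).bilinearComp A A) q := by
  have h1 : ContDiffAt ℝ n (fun r => ((G r).comp A).flip) q :=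
    (ContinuousLinearMap.flipₗᵢ ℝ E F ℝ).contDiff.contDiffAt.comp q
      (hG.clm_comp contDiffAt_const)
  exact (ContinuousLinearMap.flipₗᵢ ℝ E E ℝ).contDiff.contDiffAt.comp q
    (h1.clm_comp contDiffAt_const)

theorem contDiffAt_spacetime {n : WithTop ℕ∞} (hg : ContDiffAt ℝ n g p) :
    ContDiffAt ℝ n (spacetime g) p :=
  (contDiffAt_bilinearComp hg _).sub contDiffAt_const

theorem fderiv_spacetime_apply (hg : ContDiffAt ℝ 1 g p) (a v w : ℝ × E3) :
    fderiv ℝ (spacetime g) p a v w = fderiv ℝ g p a v.2 w.2 := by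
  rw [← fderiv_bilin_apply ((contDiffAt_spacetime hg).differentiableAt (by norm_num)),
    ← fderiv_bilin_apply (hg.differentiableAt (by norm_num))]
  simp only [spacetime_apply]
  rw [fderiv_sub_const]

theorem fderiv_fderiv_spacetime_apply (hg : ContDiffAt ℝ 2 g p) (a b v w : ℝ × E3) :
    fderiv ℝ (fderiv ℝ (spacetime g)) p a b v w = fderiv ℝ (fderiv ℝ g) p a b v.2 w.2 := by
  rw [← fderiv_fderiv_bilin_apply (contDiffAt_spacetime hg), ← fderiv_fderiv_bilin_apply hg]
  have he : (fun q => fderiv ℝ (spacetime g) q b v w) =ᶠ[𝓝 p]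
      fun q => fderiv ℝ g q b v.2 w.2 := by
    filter_upwards [hg.eventually (by simp)] with q hq
    exact fderiv_spacetime_apply (hq.of_le (by norm_num)) b v w
  rw [he.fderiv_eq]

/-- A space and its dual have equal finite dimension. Non-degeneracy rather than positivity is
assumed because the space-time metric is indefinite. -/
theorem isInvertible_of_injective {E : Type*} [NormedAddCommGroup E] [NormedSpace ℝ E]
    [FiniteDimensional ℝ E] (A : E →L[ℝ] E →L[ℝ] ℝ) (hA : ∀ v, (∀ w, A v w = 0) → v = 0) :
    A.IsInvertible := by
  have hinj : Function.Injective (A : E →ₗ[ℝ] E →L[ℝ] ℝ) := by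
    rw [← LinearMap.ker_eq_bot, LinearMap.ker_eq_bot']
    intro v hv
    exact hA v fun w => by
      have := congrArg (fun L : E →L[ℝ] ℝ => L w) hv
      simpa using this
  have hdim : Module.finrank ℝ E = Module.finrank ℝ (E →L[ℝ] ℝ) := by
    rw [← Subspace.dual_finrank_eq (K := ℝ) (V := E)]
    exact (LinearMap.toContinuousLinearMap (𝕜 := ℝ) (E := E) (F' := ℝ)).finrank_eq
  refine ⟨(LinearEquiv.ofInjectiveOfFinrankEq (A : E →ₗ[ℝ] E →L[ℝ] ℝ) hinj
    hdim).toContinuousLinearEquiv, ?_⟩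
  ext v w
  rfl

theorem isInvertible_of_pos {E : Type*} [NormedAddCommGroup E] [NormedSpace ℝ E]
    [FiniteDimensional ℝ E] {A : E →L[ℝ] E →L[ℝ] ℝ} (hA : ∀ v, v ≠ 0 → 0 < A v v) :
    A.IsInvertible :=
  isInvertible_of_injective A fun v hv => by
    by_contra h
    exact (hA v h).ne' (hv v)

theorem isInvertible_spacetime (hinv : (g p).IsInvertible) : (spacetime g p).IsInvertible := by
  apply isInvertible_of_injective
  intro v hv
  have h1 := hv (1, 0)
  have h2 : v.2 = 0 := by
    apply injective_of_isInvertible hinv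
    intro z
    have := hv (0, z)
    simpa [spacetime_apply] using this
  rw [spacetime_apply] at h1
  simp at h1
  exact Prod.ext h1 h2

theorem apply_christoffel_spacetime (hg : ContDiffAt ℝ 2 g p) (hinv : (g p).IsInvertible)
    (v w z : ℝ × E3) :
    spacetime g p (christoffel (spacetime g) p v w) z
      = (1 / 2) * (fderiv ℝ g p v w.2 z.2 + fderiv ℝ g p w v.2 z.2 - fderiv ℝ g p z v.2 w.2) := by
  rw [apply_christoffel _ _ _ _ _ (isInvertible_spacetime hinv)]
  simp only [fderiv_spacetime_apply (hg.of_le (by norm_num))]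

/-- The Codazzi equation for the slices of constant time. -/
theorem mixedCurvature_eq (hg : ContDiffAt ℝ 2 g p) (hinv : (g p).IsInvertible)
    (hsymm : ∀ q v w, g q v w = g q w v) (v w : E3) :
    mixedCurvature g u p v w
      = (1 / 2) * (fderiv ℝ (fderiv ℝ g) p (0, u p) (1, 0) v w
          - fderiv ℝ (fderiv ℝ g) p (0, w) (1, 0) v (u p))
        - (1 / 2) * fderiv ℝ g p (1, 0) w (sliceChristoffel g p v (u p))
        + (1 / 2) * fderiv ℝ g p (1, 0) (u p) (sliceChristoffel g p v w) := by
  have hd := hg.differentiableAt (by norm_num)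
  have hst : ∀ q v w, spacetime g q v w = spacetime g q w v := by
    intro q v w
    simp only [spacetime_apply, hsymm q v.2 w.2, mul_comm]
  -- The symbol Γ(∂_t, x) is purely spatial and, lowered, equals h(x, ·)/2. The time part of Γ(x, y)
  -- is not needed: in the curvature formula it is only multiplied by the vanishing time part of
  -- Γ(∂_t, ·).
  have hT (x : E3) : (christoffel (spacetime g) p (1, 0) (0, x)).1 = 0 := by
    have h := apply_christoffel_spacetime hg hinv (1, 0) (0, x) (1, 0)
    rw [spacetime_apply] at h
    simpa using h
  have hTs (x z : E3) : g p (christoffel (spacetime g) p (1, 0) (0, x)).2 z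
      = (1 / 2) * fderiv ℝ g p (1, 0) x z := by
    have h := apply_christoffel_spacetime hg hinv (1, 0) (0, x) (0, z)
    rw [spacetime_apply] at h
    simpa using h
  have hS (x y : E3) : (christoffel (spacetime g) p (0, x) (0, y)).2 = sliceChristoffel g p x y := by
    apply injective_of_isInvertible hinv
    intro z
    have h := apply_christoffel_spacetime hg hinv (0, x) (0, y) (0, z)
    rw [spacetime_apply] at h
    rw [apply_sliceChristoffel hd hinv]
    simpa using h
  rw [mixedCurvature, apply_curvature (contDiffAt_spacetime hg) hst (isInvertible_spacetime hinv)]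
  simp only [fderiv_fderiv_spacetime_apply hg]
  rw [spacetime_apply, spacetime_apply, hT, hT, hTs, hS, hS, hsymm p _ (Prod.snd _), hTs,
    fderiv_fderiv_swap hg (1, 0) (0, u p), fderiv_fderiv_swap hg (1, 0) (0, w)]
  simp

end NullFlow

/-! ### The derivative of g(∇u, ·) along ∂_t + u. -/

namespace NullFlow

variable {g : ℝ × E3 → E3 →L[ℝ] E3 →L[ℝ] ℝ} {u : ℝ × E3 → E3} {p : ℝ × E3}

/-- At the point `p` and, within the slice of constant time, near `p`, the field `u` is a unit
field with `∂u/∂t = - ∇_u u`, and the time derivative of `g` is horizontal. -/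
structure IsFlowAt (g : ℝ × E3 → E3 →L[ℝ] E3 →L[ℝ] ℝ) (u : ℝ × E3 → E3) (p : ℝ × E3) :
    Prop where
  smooth_metric : ContDiffAt ℝ 2 g p
  smooth_field : ContDiffAt ℝ 2 u p
  symm : ∀ q v w, g q v w = g q w v
  inv : (g p).IsInvertible
  unit : ∀ᶠ z in 𝓝 p.2, g (p.1, z) (u (p.1, z)) (u (p.1, z)) = 1
  field : ∀ᶠ z in 𝓝 p.2, fderiv ℝ u (p.1, z) (1, 0) = - sliceCov g u (p.1, z) (u (p.1, z))
  metric : ∀ᶠ z in 𝓝 p.2, ∀ w, fderiv ℝ g (p.1, z) (1, 0) (u (p.1, z)) w = 0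

theorem sliceCov_add (v w : E3) :
    sliceCov g u p (v + w) = sliceCov g u p v + sliceCov g u p w := by
  simp only [sliceCov, cov, map_add, christoffel_add_left]
  abel

theorem sliceCov_smul (c : ℝ) (v : E3) : sliceCov g u p (c • v) = c • sliceCov g u p v := by
  simp only [sliceCov, cov, map_smul, christoffel_smul_left, smul_add]

theorem shape_add_left (v v' w : E3) :
    shape g u p (v + v') w = shape g u p v w + shape g u p v' w := by
  simp [shape, sliceCov_add]

theorem shape_smul_left (c : ℝ) (v w : E3) : shape g u p (c • v) w = c * shape g u p v w := by
  simp [shape, sliceCov_smul]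

theorem shape_add_right (v w w' : E3) :
    shape g u p v (w + w') = shape g u p v w + shape g u p v w' := by
  simp [shape]

theorem shape_smul_right (c : ℝ) (v w : E3) : shape g u p v (c • w) = c * shape g u p v w := by
  simp [shape]

namespace IsFlowAt

theorem differentiableAt_metric (hf : IsFlowAt g u p) : DifferentiableAt ℝ g p :=
  hf.smooth_metric.differentiableAt (by norm_num)

theorem differentiableAt_field (hf : IsFlowAt g u p) : DifferentiableAt ℝ u p :=
  hf.smooth_field.differentiableAt (by norm_num)

/-- Half the spatial derivative of the constant g(u, u) = 1. -/
theorem shape_field_right (hf : IsFlowAt g u p) (v : E3) : shape g u p v (u p) = 0 := by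
  have hg := hf.differentiableAt_metric
  have hu := hf.differentiableAt_field
  have h := ((hg.hasFDerivAt.clm_apply hu.hasFDerivAt).clm_apply hu.hasFDerivAt)
  have h1 := fderiv_slice_apply h.differentiableAt v
  have h2 : (fun z => g (p.1, z) (u (p.1, z)) (u (p.1, z))) =ᶠ[𝓝 p.2] fun _ => 1 := hf.unit
  rw [h2.fderiv_eq, h.fderiv] at h1
  simp at h1
  rw [shape_eq hg hu hf.inv]
  have h3 := hf.symm p (u p) (fderiv ℝ u p (0, v))
  have h4 := fderiv_bilin_symm hg hf.symm (0, u p) v (u p)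
  linarith

/-- The spatial derivative of h(u, ·) = 0. It trades second derivatives of g for h(∂_v u, w). -/
theorem fderiv_metric_field (hf : IsFlowAt g u p) (v w : E3) :
    fderiv ℝ (fderiv ℝ g) p (0, v) (1, 0) (u p) w
      + fderiv ℝ g p (1, 0) (fderiv ℝ u p (0, v)) w = 0 := by
  have hu := hf.differentiableAt_field
  have h := (((differentiableAt_fderiv hf.smooth_metric).hasFDerivAt.clm_apply
    (hasFDerivAt_const (1, 0) p)).clm_apply hu.hasFDerivAt).clm_apply (hasFDerivAt_const w p)
  have h1 := fderiv_slice_apply h.differentiableAt v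
  have h2 : (fun z => fderiv ℝ g (p.1, z) (1, 0) (u (p.1, z)) w) =ᶠ[𝓝 p.2] fun _ => 0 :=
    hf.metric.mono fun z hz => hz w
  rw [h2.fderiv_eq, h.fderiv] at h1
  simp at h1
  linarith

theorem field_eq (hf : IsFlowAt g u p) : fderiv ℝ u p (1, 0)
    = - (fderiv ℝ u p (0, u p) + sliceChristoffel g p (u p) (u p)) := by
  rw [← sliceCov_eq hf.differentiableAt_field]
  exact hf.field.self_of_nhds

theorem metric_eq (hf : IsFlowAt g u p) (w : E3) : fderiv ℝ g p (1, 0) (u p) w = 0 :=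
  hf.metric.self_of_nhds w

theorem hasFDerivAt_fderiv_field_apply (hf : IsFlowAt g u p) {X : ℝ × E3 → E3} {X' : ℝ × E3 →L[ℝ] E3}
    (hX : HasFDerivAt X X' p) :
    HasFDerivAt (fun q => fderiv ℝ u q (0, X q)) ((fderiv ℝ u p).comp
      ((0 : ℝ × E3 →L[ℝ] ℝ).prod X') + (fderiv ℝ (fderiv ℝ u) p).flip (0, X p)) p :=
  (differentiableAt_fderiv hf.smooth_field).hasFDerivAt.clm_apply
    ((hasFDerivAt_const (0 : ℝ) p).prodMk hX)

/-- Existential because only the values of the derivative matter, not its expression as a composite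
of linear maps. -/
theorem hasFDerivAt_fderiv_metric_apply (hf : IsFlowAt g u p) {X Y Z : ℝ × E3 → E3} {X' Y' Z' : ℝ × E3 →L[ℝ] E3}
    (hX : HasFDerivAt X X' p) (hY : HasFDerivAt Y Y' p) (hZ : HasFDerivAt Z Z' p) :
    ∃ L : ℝ × E3 →L[ℝ] ℝ, HasFDerivAt (fun q => fderiv ℝ g q (0, X q) (Y q) (Z q)) L p ∧
      ∀ a, L a = fderiv ℝ (fderiv ℝ g) p a (0, X p) (Y p) (Z p)
        + fderiv ℝ g p (0, X' a) (Y p) (Z p) + fderiv ℝ g p (0, X p) (Y' a) (Z p)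
        + fderiv ℝ g p (0, X p) (Y p) (Z' a) := by
  refine ⟨_, (((differentiableAt_fderiv hf.smooth_metric).hasFDerivAt.clm_apply
    ((hasFDerivAt_const (0 : ℝ) p).prodMk hX)).clm_apply hY).clm_apply hZ, fun a => ?_⟩
  simp
  ring

/-- The equation ∂u/∂t = -∇_u u, lowered by g and differentiated along the slice. A time derivative
would not be available: the equation is known only at times in I, and p may lie over an end point.
-/
theorem fderiv_field_eq (hf : IsFlowAt g u p) (v w : E3) :
    g p (fderiv ℝ (fderiv ℝ u) p (0, v) (1, 0)) w + fderiv ℝ g p (0, v) (fderiv ℝ u p (1, 0)) w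
      = - (g p (fderiv ℝ (fderiv ℝ u) p (0, v) (0, u p)) w
          + g p (fderiv ℝ u p (0, fderiv ℝ u p (0, v))) w
          + fderiv ℝ g p (0, v) (fderiv ℝ u p (0, u p)) w)
        - (fderiv ℝ (fderiv ℝ g) p (0, v) (0, u p) (u p) w
          + fderiv ℝ g p (0, fderiv ℝ u p (0, v)) (u p) w
          + fderiv ℝ g p (0, u p) (fderiv ℝ u p (0, v)) w
          - (1 / 2) * fderiv ℝ (fderiv ℝ g) p (0, v) (0, w) (u p) (u p)
          - fderiv ℝ g p (0, w) (fderiv ℝ u p (0, v)) (u p)) := by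
  have hg := hf.differentiableAt_metric
  have hu := hf.differentiableAt_field
  have hw := hasFDerivAt_const (𝕜 := ℝ) w p
  have hl := (hg.hasFDerivAt.clm_apply ((differentiableAt_fderiv hf.smooth_field).hasFDerivAt.clm_apply
    (hasFDerivAt_const (1, 0) p))).clm_apply hw
  have hr1 := (hg.hasFDerivAt.clm_apply
    (hf.hasFDerivAt_fderiv_field_apply hu.hasFDerivAt)).clm_apply hw
  obtain ⟨L1, hL1, hL1'⟩ :=
    hf.hasFDerivAt_fderiv_metric_apply hu.hasFDerivAt hu.hasFDerivAt hw
  obtain ⟨L2, hL2, hL2'⟩ :=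
    hf.hasFDerivAt_fderiv_metric_apply hw hu.hasFDerivAt hu.hasFDerivAt
  have hr := (hr1.add (hL1.sub (hL2.const_mul (1 / 2)))).neg
  have h1 := fderiv_slice_apply hl.differentiableAt v
  have h2 := fderiv_slice_apply hr.differentiableAt v
  have he : (fun z => g (p.1, z) (fderiv ℝ u (p.1, z) (1, 0)) w) =ᶠ[𝓝 p.2]
      fun z => -(((fun q => g q (fderiv ℝ u q (0, u q)) w)
        + ((fun q => fderiv ℝ g q (0, u q) (u q) w)
          - fun q => (1 / 2) * fderiv ℝ g q (0, w) (u q) (u q))) (p.1, z)) := by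
    have ht := tendsto_slice p
    filter_upwards [hf.field, ht.eventually (hf.smooth_metric.eventually (by simp)),
      ht.eventually (hf.smooth_field.eventually (by simp)),
      ht.eventually (eventually_isInvertible hg.continuousAt hf.inv)] with z h3 h4 h5 h6
    have h7 := shape_eq (h4.differentiableAt (by norm_num)) (h5.differentiableAt (by norm_num)) h6
      (u (p.1, z)) w
    rw [shape] at h7
    rw [h3, map_neg, neg_apply, h7]
    simp
    ring
  rw [he.fderiv_eq] at h1
  simp only [Pi.neg_apply] at h2
  rw [h2, hl.fderiv, hr.fderiv] at h1
  have h0 : ((0 : ℝ), (0 : E3)) = 0 := rfl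
  simp [hL1', hL2', h0] at h1
  have h8 := fderiv_bilin_symm hg hf.symm (0, w) (u p) (fderiv ℝ u p (0, v))
  linarith

set_option maxHeartbeats 1000000 in
/-- The evolution of `g(∇_X u, Y)` along `∂_t + u`. -/
theorem fderiv_shape (hf : IsFlowAt g u p) {X Y : ℝ × E3 → E3} (hX : DifferentiableAt ℝ X p)
    (hY : DifferentiableAt ℝ Y p) :
    DifferentiableAt ℝ (fun q => shape g u q (X q) (Y q)) p ∧
    fderiv ℝ (fun q => shape g u q (X q) (Y q)) p (1, u p)
      = - shape g u p (sliceCov g u p (X p)) (Y p)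
        - g p (curvature (fun z => g (p.1, z)) p.2 (X p) (u p) (u p)) (Y p)
        + (1 / 2) * (fderiv ℝ (fderiv ℝ g) p (0, u p) (1, 0) (X p) (Y p)
          - fderiv ℝ g p (1, 0) (sliceChristoffel g p (u p) (X p)) (Y p)
          - fderiv ℝ g p (1, 0) (X p) (sliceChristoffel g p (u p) (Y p)))
        + (1 / 2) * fderiv ℝ g p (1, 0) (sliceCov g u p (X p)) (Y p)
        + (1 / 2) * fderiv ℝ g p (1, 0) (X p) (sliceCov g u p (Y p))
        + shape g u p (fderiv ℝ X p (1, u p) + sliceChristoffel g p (u p) (X p)) (Y p)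
        + shape g u p (X p) (fderiv ℝ Y p (1, u p) + sliceChristoffel g p (u p) (Y p)) := by
  have hg := hf.differentiableAt_metric
  have hu := hf.differentiableAt_field
  have h1 := (hg.hasFDerivAt.clm_apply
    (hf.hasFDerivAt_fderiv_field_apply hX.hasFDerivAt)).clm_apply hY.hasFDerivAt
  obtain ⟨L1, hL1, hL1'⟩ :=
    hf.hasFDerivAt_fderiv_metric_apply hX.hasFDerivAt hu.hasFDerivAt hY.hasFDerivAt
  obtain ⟨L2, hL2, hL2'⟩ :=
    hf.hasFDerivAt_fderiv_metric_apply hu.hasFDerivAt hX.hasFDerivAt hY.hasFDerivAt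
  obtain ⟨L3, hL3, hL3'⟩ :=
    hf.hasFDerivAt_fderiv_metric_apply hY.hasFDerivAt hX.hasFDerivAt hu.hasFDerivAt
  have hr := h1.add (((hL1.add hL2).sub hL3).const_mul (1 / 2))
  have he : (fun q => shape g u q (X q) (Y q)) =ᶠ[𝓝 p]
      ((fun q => g q (fderiv ℝ u q (0, X q)) (Y q)) + fun q => (1 / 2) *
        (((fun q => fderiv ℝ g q (0, X q) (u q) (Y q))
          + (fun q => fderiv ℝ g q (0, u q) (X q) (Y q))
          - fun q => fderiv ℝ g q (0, Y q) (X q) (u q)) q)) := by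
    filter_upwards [hf.smooth_metric.eventually (by simp), hf.smooth_field.eventually (by simp),
      eventually_isInvertible hg.continuousAt hf.inv] with q h4 h5 h6
    exact shape_eq (h4.differentiableAt (by norm_num)) (h5.differentiableAt (by norm_num)) h6 _ _
  have hs := hr.congr_of_eventuallyEq he
  refine ⟨hs.differentiableAt, ?_⟩
  rw [hs.fderiv]
  -- The jets of g and u at p with their derivative slots restricted to spatial directions; the
  -- flips restore the order of these slots.
  let ι := ContinuousLinearMap.inr ℝ ℝ E3
  have hι (v : E3) : ι v = (0, v) := rfl
  let g1 := (fderiv ℝ g p).comp ι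
  let h1' : E3 →L[ℝ] E3 →L[ℝ] E3 →L[ℝ] ℝ := ((fderiv ℝ (fderiv ℝ g) p).flip (1, 0)).comp ι
  let g2 : E3 →L[ℝ] E3 →L[ℝ] E3 →L[ℝ] E3 →L[ℝ] ℝ :=
    (((fderiv ℝ (fderiv ℝ g) p).comp ι).flip.comp ι).flip
  let u2 : E3 →L[ℝ] E3 →L[ℝ] E3 := (((fderiv ℝ (fderiv ℝ u) p).comp ι).flip.comp ι).flip
  let uT1 : E3 →L[ℝ] E3 := ((fderiv ℝ (fderiv ℝ u) p).flip (1, 0)).comp ι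
  have key := shape_evolution_jet (g p) (fderiv ℝ g p (1, 0)) g1 h1' g2 (u p)
    (fderiv ℝ u p (1, 0)) ((fderiv ℝ u p).comp ι) uT1 u2 (sliceChristoffel g p)
    (hf.symm p) (fderiv_bilin_symm hg hf.symm (1, 0)) (fun a => fderiv_bilin_symm hg hf.symm (0, a))
    (fun a => fderiv_fderiv_bilin_symm hf.smooth_metric hf.symm (0, a) (1, 0))
    (fun a b => fderiv_fderiv_bilin_symm hf.smooth_metric hf.symm (0, a) (0, b))
    (fun a b => fderiv_fderiv_swap hf.smooth_metric (0, a) (0, b))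
    (fun a b => fderiv_fderiv_swap hf.smooth_field (0, a) (0, b))
    (sliceChristoffel_comm hg hf.inv hf.symm) (apply_sliceChristoffel hg hf.inv)
    hf.fderiv_metric_field hf.field_eq hf.fderiv_field_eq (X p) (Y p)
  have hW : ((1 : ℝ), u p) = (1, 0) + (0, u p) := by simp
  rw [apply_slice_curvature hf.smooth_metric hf.inv hf.symm, shape_add_left, shape_add_right,
    shape_eq hg hu hf.inv (fderiv ℝ X p (1, u p)), shape_eq hg hu hf.inv _ (fderiv ℝ Y p (1, u p))]
  have e1 : shape g u p (sliceCov g u p (X p)) (Y p) = g p (fderiv ℝ u p (0, sliceCov g u p (X p))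
      + sliceChristoffel g p (sliceCov g u p (X p)) (u p)) (Y p) := by
    rw [shape, sliceCov_eq hu]
  have e2 : shape g u p (sliceChristoffel g p (u p) (X p)) (Y p)
      = g p (fderiv ℝ u p (0, sliceChristoffel g p (u p) (X p))
      + sliceChristoffel g p (sliceChristoffel g p (u p) (X p)) (u p)) (Y p) := by
    rw [shape, sliceCov_eq hu]
  have e3 : shape g u p (X p) (sliceChristoffel g p (u p) (Y p))
      = g p (sliceCov g u p (X p)) (sliceChristoffel g p (u p) (Y p)) := rfl
  rw [e1, e2, e3, sliceCov_eq hu, sliceCov_eq hu]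
  -- Differentiating along (1, u) puts the time direction first, whereas the jets in `key` have the
  -- spatial direction first; second derivatives commute.
  have d1 (a b : ℝ × E3) (v w : E3) := congrArg (fun L : E3 →L[ℝ] E3 →L[ℝ] ℝ => L v w)
    (fderiv_fderiv_swap hf.smooth_metric a b)
  have d2 := fderiv_fderiv_swap hf.smooth_field (1, 0) (0, X p)
  simp only [g1, h1', g2, u2, uT1] at key
  -- The jets and ι become opaque, so that both sides normalise to the same atoms.
  clear_value g1 h1' g2 u2 uT1 ι
  simp only [← hι] at key hL1' hL2' hL3' d2 hW ⊢
  simp only [ContinuousLinearMap.comp_apply, ContinuousLinearMap.flip_apply, map_add,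
    add_apply] at key
  simp only [ContinuousLinearMap.comp_apply, ContinuousLinearMap.flip_apply, add_apply, sub_apply,
    smul_apply, ContinuousLinearMap.prod_apply, zero_apply, hL1', hL2', hL3', hW, map_add,
    ← hι, smul_eq_mul]
  have d5 := d1 (1, 0) (ι (X p)) (u p) (Y p)
  have d6 := d1 (1, 0) (ι (Y p)) (X p) (u p)
  have d7 := d1 (1, 0) (ι (u p)) (X p) (Y p)
  rw [d2, d5, d6, d7]
  linarith

end IsFlowAt

end NullFlow

/-! ### Orthonormal frames, Ricci and mixed curvature on u^⊥. -/

namespace NullFlow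

section Frame

variable {b : E3 →L[ℝ] E3 →L[ℝ] ℝ} {u X Y : E3}

/-- Orthonormality gives independence, and three independent vectors span; the coefficients are
found by pairing with the frame. -/
theorem IsComplementaryFrame.expand (hb : ∀ v w, b v w = b w v) (hu : b u u = 1)
    (h : IsComplementaryFrame b u X Y) (v : E3) :
    v = b v u • u + b v X • X + b v Y • Y := by
  have hXu : b X u = 0 := by rw [hb]; exact h.orth_uX
  have hYu : b Y u = 0 := by rw [hb]; exact h.orth_uY
  have hYX : b Y X = 0 := by rw [hb]; exact h.orth_XY
  have hli : LinearIndependent ℝ ![u, X, Y] := by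
    rw [Fintype.linearIndependent_iff]
    intro c hc
    simp only [Fin.sum_univ_three, Matrix.cons_val] at hc
    have e (z : E3) : c 0 * b u z + c 1 * b X z + c 2 * b Y z = 0 := by
      have := congrArg (fun q => b q z) hc
      simpa using this
    have e0 := e u
    have e1 := e X
    have e2 := e Y
    simp only [hu, hXu, hYu, hYX, h.norm_X, h.norm_Y, h.orth_XY, h.orth_uX, h.orth_uY, mul_zero,
      mul_one, add_zero, zero_add] at e0 e1 e2
    intro i
    fin_cases i <;> assumption
  have hspan := hli.span_eq_top_of_card_eq_finrank' (by simp)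
  have hv : v ∈ Submodule.span ℝ (Set.range ![u, X, Y]) := by rw [hspan]; trivial
  obtain ⟨c, rfl⟩ := (Submodule.mem_span_range_iff_exists_fun ℝ).1 hv
  simp only [Fin.sum_univ_three, Matrix.cons_val, map_add, map_smul, add_apply, smul_apply, hu,
    hXu, hYu, hYX, h.norm_X, h.norm_Y, h.orth_XY, h.orth_uX, h.orth_uY, smul_eq_mul, mul_zero,
    mul_one, add_zero, zero_add]

/-- The trace of an endomorphism in an orthonormal basis. -/
theorem IsComplementaryFrame.sum_coord (hb : ∀ v w, b v w = b w v) (hu : b u u = 1)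
    (h : IsComplementaryFrame b u X Y) (L : E3 → E3) (hadd : ∀ v w, L (v + w) = L v + L w)
    (hsmul : ∀ (c : ℝ) v, L (c • v) = c • L v) :
    ∑ i : Fin 3, (L (EuclideanSpace.single i 1)) i = b (L u) u + b (L X) X + b (L Y) Y := by
  have e (v z : E3) : b v z = ∑ i : Fin 3, v i * b (EuclideanSpace.single i 1) z := by
    conv_lhs => rw [← (EuclideanSpace.basisFun (Fin 3) ℝ).sum_repr v]
    simp
  rw [e (L u) u, e (L X) X, e (L Y) Y, ← Finset.sum_add_distrib, ← Finset.sum_add_distrib]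
  refine Finset.sum_congr rfl fun i _ => ?_
  conv_lhs => rw [h.expand hb hu (EuclideanSpace.single i 1)]
  simp only [hadd, hsmul, PiLp.add_apply, PiLp.smul_apply, smul_eq_mul]
  ring

end Frame

variable {g : ℝ × E3 → E3 →L[ℝ] E3 →L[ℝ] ℝ} {u : ℝ × E3 → E3} {p : ℝ × E3}

/-- The derivative of the vector field `X` along `∂_t + u`, covariant in the spatial directions. -/
def flowDeriv (g : ℝ × E3 → E3 →L[ℝ] E3 →L[ℝ] ℝ) (u X : ℝ × E3 → E3) (p : ℝ × E3) : E3 :=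
  fderiv ℝ X p (1, u p) + sliceChristoffel g p (u p) (X p)

namespace IsFlowAt

/-- Not visible from the definition, which differentiates the symbols for fixed arguments; it is
read off from the lowered formula. It makes the trace defining Ricci independent of the basis. -/
theorem curvature_linear (hf : IsFlowAt g u p) (v w : E3) :
    (∀ z z', curvature (fun z => g (p.1, z)) p.2 (z + z') v w
      = curvature (fun z => g (p.1, z)) p.2 z v w + curvature (fun z => g (p.1, z)) p.2 z' v w) ∧
    ∀ (c : ℝ) z, curvature (fun z => g (p.1, z)) p.2 (c • z) v w
      = c • curvature (fun z => g (p.1, z)) p.2 z v w := by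
  have hR := apply_slice_curvature hf.smooth_metric hf.inv hf.symm
  have i1 (x y : E3) : ((0 : ℝ), x + y) = (0, x) + (0, y) := by simp
  have i2 (c : ℝ) (x : E3) : ((0 : ℝ), c • x) = c • (0, x) := by simp
  constructor
  · intro z z'
    apply injective_of_isInvertible hf.inv
    intro q
    rw [map_add, add_apply, hR, hR, hR]
    simp only [sliceChristoffel, christoffel_add_left, map_add, add_apply, i1]
    ring
  · intro c z
    apply injective_of_isInvertible hf.inv
    intro q
    rw [map_smul, smul_apply, hR, hR]
    simp only [sliceChristoffel, christoffel_smul_left, map_smul, smul_apply, i2, smul_eq_mul]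
    ring

theorem ricci_eq (hf : IsFlowAt g u p) {X Y : E3} (h : IsComplementaryFrame (g p) (u p) X Y)
    (v w : E3) :
    ricci (fun z => g (p.1, z)) p.2 v w
      = g p (curvature (fun z => g (p.1, z)) p.2 (u p) v w) (u p)
        + g p (curvature (fun z => g (p.1, z)) p.2 X v w) X
        + g p (curvature (fun z => g (p.1, z)) p.2 Y v w) Y := by
  obtain ⟨h1, h2⟩ := hf.curvature_linear v w
  exact h.sum_coord (hf.symm p) hf.unit.self_of_nhds
    (fun z => curvature (fun z => g (p.1, z)) p.2 z v w) h1 h2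

/-- The horizontal trace-free parts of the Ricci tensor and of `R(·, u)u` agree. -/
theorem ricci_horizontal (hf : IsFlowAt g u p) {X Y : E3}
    (h : IsComplementaryFrame (g p) (u p) X Y) :
    ∃ K : ℝ,
      ricci (fun z => g (p.1, z)) p.2 X X
        = g p (curvature (fun z => g (p.1, z)) p.2 X (u p) (u p)) X + K ∧
      ricci (fun z => g (p.1, z)) p.2 Y Y
        = g p (curvature (fun z => g (p.1, z)) p.2 Y (u p) (u p)) Y + K ∧
      ricci (fun z => g (p.1, z)) p.2 X Y
        = g p (curvature (fun z => g (p.1, z)) p.2 X (u p) (u p)) Y ∧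
      ricci (fun z => g (p.1, z)) p.2 Y X
        = g p (curvature (fun z => g (p.1, z)) p.2 Y (u p) (u p)) X := by
  have hR := apply_slice_curvature hf.smooth_metric hf.inv hf.symm
  have hd (a b : ℝ × E3) := fderiv_fderiv_swap hf.smooth_metric a b
  have hs (a b : ℝ × E3) := fderiv_fderiv_bilin_symm hf.smooth_metric hf.symm a b
  have hΓ := sliceChristoffel_comm hf.differentiableAt_metric hf.inv hf.symm
  have h12 (v w z q : E3) : g p (curvature (fun z => g (p.1, z)) p.2 v w z) q
      = - g p (curvature (fun z => g (p.1, z)) p.2 w v z) q := by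
    rw [hR, hR]
    ring
  have h34 (v w z q : E3) : g p (curvature (fun z => g (p.1, z)) p.2 v w z) q
      = - g p (curvature (fun z => g (p.1, z)) p.2 v w q) z := by
    rw [hR, hR, hf.symm p (sliceChristoffel g p w q), hf.symm p (sliceChristoffel g p v q)]
    ring
  have hself (v w z : E3) : g p (curvature (fun z => g (p.1, z)) p.2 v w z) z = 0 := by
    have := h34 v w z z
    linarith
  have hself' (v w z : E3) : g p (curvature (fun z => g (p.1, z)) p.2 v v w) z = 0 := by
    have := h12 v v w z
    linarith
  have hcomm (v w z q : E3) : g p (curvature (fun z => g (p.1, z)) p.2 v w z) q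
      = g p (curvature (fun z => g (p.1, z)) p.2 w v q) z := by
    rw [h12, h34, neg_neg]
  -- K is the sectional curvature of u^⊥. For each horizontal direction only one other horizontal
  -- direction contributes to the trace, so the diagonal entries gain the same K and the
  -- off-diagonal ones nothing.
  refine ⟨g p (curvature (fun z => g (p.1, z)) p.2 Y X X) Y, ?_, ?_, ?_, ?_⟩
  · rw [hf.ricci_eq h, hself', hcomm (u p)]
    ring
  · rw [hf.ricci_eq h, hself', hcomm (u p), hcomm X]
    ring
  · rw [hf.ricci_eq h, hself', hself Y, hcomm (u p)]
    ring
  · rw [hf.ricci_eq h, hself', hself X, hcomm (u p)]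
    ring

/-- The first bracket is (∇_u h)(v, w). The other derivatives of h in the Codazzi equation contain
h(·, u), so the differentiated identity h(u, ·) = 0 turns them into first-order terms; the last
bracket collects these. -/
theorem mixedCurvature_sym (hf : IsFlowAt g u p) (v w : E3) :
    (1 / 2) * (mixedCurvature g u p v w + mixedCurvature g u p w v)
      = (1 / 2) * (fderiv ℝ (fderiv ℝ g) p (0, u p) (1, 0) v w
          - fderiv ℝ g p (1, 0) (sliceChristoffel g p (u p) v) w
          - fderiv ℝ g p (1, 0) v (sliceChristoffel g p (u p) w))
        + (1 / 4) * (fderiv ℝ g p (1, 0) (sliceCov g u p v) w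
          + fderiv ℝ g p (1, 0) v (sliceCov g u p w)) := by
  have hg := hf.differentiableAt_metric
  have hu := hf.differentiableAt_field
  rw [mixedCurvature_eq hf.smooth_metric hf.inv hf.symm,
    mixedCurvature_eq hf.smooth_metric hf.inv hf.symm, hf.metric_eq, hf.metric_eq,
    sliceCov_eq hu, sliceCov_eq hu, sliceChristoffel_comm hg hf.inv hf.symm v (u p),
    sliceChristoffel_comm hg hf.inv hf.symm w (u p)]
  have a1 := hf.fderiv_metric_field v w
  have a2 := hf.fderiv_metric_field w v
  have a3 (x y z : E3) := fderiv_fderiv_bilin_symm hf.smooth_metric hf.symm (0, x) (1, 0) y z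
  have a4 := fderiv_bilin_symm hg hf.symm (1, 0)
  rw [a3 w v (u p), a3 v w (u p), a3 (u p) w v, a4 w]
  rw [a4 _ v] at a2
  simp only [map_add, add_apply]
  linarith

/-- The field equation as parallel transport: u is parallel along ∂_t + u. It keeps frames of u^⊥
horizontal to first order and yields the geodesic equation. -/
theorem flowDeriv_field (hf : IsFlowAt g u p) : flowDeriv g u u p = 0 := by
  have hW : ((1 : ℝ), u p) = (1, 0) + (0, u p) := by simp
  rw [flowDeriv, hW, map_add, hf.field_eq]
  abel

/-- `flowDeriv` is metric only in spatial directions, so the product rule carries the extra term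
h(X, Y). -/
theorem metric_flowDeriv (hf : IsFlowAt g u p) {X Y : ℝ × E3 → E3} (hX : DifferentiableAt ℝ X p)
    (hY : DifferentiableAt ℝ Y p) {c : ℝ} (h : ∀ᶠ q in 𝓝 p, g q (X q) (Y q) = c) :
    fderiv ℝ g p (1, 0) (X p) (Y p) + g p (flowDeriv g u X p) (Y p)
      + g p (X p) (flowDeriv g u Y p) = 0 := by
  have hg := hf.differentiableAt_metric
  have h1 := (hg.hasFDerivAt.clm_apply hX.hasFDerivAt).clm_apply hY.hasFDerivAt
  have h2 : (fun q => g q (X q) (Y q)) =ᶠ[𝓝 p] fun _ => c := h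
  have h3 := h1.fderiv
  rw [h2.fderiv_eq] at h3
  have h4 := congrArg (fun L : ℝ × E3 →L[ℝ] ℝ => L (1, u p)) h3
  have hW : ((1 : ℝ), u p) = (1, 0) + (0, u p) := by simp
  simp at h4
  have h5 : fderiv ℝ g p (1, u p) (X p) (Y p) = fderiv ℝ g p (1, 0) (X p) (Y p)
      + fderiv ℝ g p (0, u p) (X p) (Y p) := by
    rw [hW, map_add]; rfl
  simp only [flowDeriv, map_add, add_apply]
  rw [hf.symm p (X p) (sliceChristoffel g p (u p) (Y p)), apply_sliceChristoffel hg hf.inv,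
    apply_sliceChristoffel hg hf.inv]
  have a1 := fderiv_bilin_symm hg hf.symm (0, u p) (X p) (Y p)
  have a2 := fderiv_bilin_symm hg hf.symm (0, X p) (u p) (Y p)
  have a3 := fderiv_bilin_symm hg hf.symm (0, Y p) (u p) (X p)
  linarith

end IsFlowAt

end NullFlow

/-! ### The differential equation for the defect. -/

namespace NullFlow

variable {g : ℝ × E3 → E3 →L[ℝ] E3 →L[ℝ] ℝ} {u : ℝ × E3 → E3} {p : ℝ × E3}

/-- The squared deviation of the tensor `g(∇u, ·)` on `u^⊥` from a multiple of the metric, in the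
orthonormal frame `X`, `Y` of `u^⊥`. -/
def defect (g : ℝ × E3 → E3 →L[ℝ] E3 →L[ℝ] ℝ) (u : ℝ × E3 → E3) (p : ℝ × E3) (X Y : E3) : ℝ :=
  (shape g u p X X - shape g u p Y Y) ^ 2 + (shape g u p X Y + shape g u p Y X) ^ 2
    + (shape g u p X Y - shape g u p Y X) ^ 2

theorem defect_nonneg (X Y : E3) : 0 ≤ defect g u p X Y := by
  unfold defect; positivity

/-- In the frame X, Y: b is `shape`, d its derivative along ∂_t + u, h the time derivative of g, l
the `flowDeriv` of the frame, r the form g(R(·, u)u, ·) and n half of ∇_u h. The c are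
orthonormality, the m the metric equation, the e the evolution of b. Solving the m for n removes
every r, and K cancels in dxx - dyy. -/
theorem defect_evolution_algebra
    {bxx bxy byx byy hxx hxy hyy lxx lxy lyx lyy K rxx rxy ryx ryy nxx nxy nyx nyy
      dxx dxy dyx dyy : ℝ}
    (cxx : hxx + lxx + lxx = 0) (cxy : hxy + lxy + lyx = 0) (cyy : hyy + lyy + lyy = 0)
    (mxx : (bxx + byy) * hxx = 4 * (-(rxx + K) + (nxx + (bxx * hxx + bxy * hxy) / 2)))
    (mxy : (bxx + byy) * hxy
      = 4 * (-rxy + (nxy + (bxx * hxy + bxy * hyy + byx * hxx + byy * hxy) / 4)))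
    (myx : (bxx + byy) * hxy
      = 4 * (-ryx + (nyx + (bxx * hxy + bxy * hyy + byx * hxx + byy * hxy) / 4)))
    (myy : (bxx + byy) * hyy = 4 * (-(ryy + K) + (nyy + (byx * hxy + byy * hyy) / 2)))
    (exx : dxx = -(bxx * bxx + bxy * byx) - rxx + nxx + (bxx * hxx + bxy * hxy)
      + (lxx * bxx + lxy * byx) + (lxx * bxx + lxy * bxy))
    (exy : dxy = -(bxx * bxy + bxy * byy) - rxy + nxy
      + (bxx * hxy + bxy * hyy + byx * hxx + byy * hxy) / 2
      + (lxx * bxy + lxy * byy) + (lyx * bxx + lyy * bxy))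
    (eyx : dyx = -(byx * bxx + byy * byx) - ryx + nyx
      + (bxx * hxy + bxy * hyy + byx * hxx + byy * hxy) / 2
      + (lyx * bxx + lyy * byx) + (lxx * byx + lxy * byy))
    (eyy : dyy = -(byx * bxy + byy * byy) - ryy + nyy + (byx * hxy + byy * hyy)
      + (lyx * bxy + lyy * byy) + (lyx * byx + lyy * byy)) :
    2 * (bxx - byy) * (dxx - dyy) + 2 * (bxy + byx) * (dxy + dyx) + 2 * (bxy - byx) * (dxy - dyx)
      = - 2 * (bxx + byy + (hxx + hyy) / 4) * ((bxx - byy) ^ 2 + (bxy + byx) ^ 2)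
        - (2 * (bxx + byy) + (hxx + hyy)) * (bxy - byx) ^ 2
        + hxy * (bxx - byy) * (bxy - byx) - (hxx - hyy) / 2 * (bxy + byx) * (bxy - byx) := by
  obtain rfl : lxx = - hxx / 2 := by linarith
  obtain rfl : lyy = - hyy / 2 := by linarith
  -- The rotation rate lxy of the frame stays free; it drops out because the defect is invariant
  -- under rotations of the frame.
  obtain rfl : lyx = - hxy - lxy := by linarith
  obtain rfl : nxx = (bxx + byy) * hxx / 4 + rxx + K - (bxx * hxx + bxy * hxy) / 2 := by linarith
  obtain rfl : nyy = (bxx + byy) * hyy / 4 + ryy + K - (byx * hxy + byy * hyy) / 2 := by linarith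
  obtain rfl : nxy = (bxx + byy) * hxy / 4 + rxy
    - (bxx * hxy + bxy * hyy + byx * hxx + byy * hxy) / 4 := by linarith
  obtain rfl : nyx = (bxx + byy) * hxy / 4 + ryx
    - (bxx * hxy + bxy * hyy + byx * hxx + byy * hxy) / 4 := by linarith
  subst exx exy eyx eyy
  ring

set_option maxHeartbeats 1000000 in
/-- Along `∂_t + u` the defect satisfies a homogeneous differential equation. -/
theorem IsFlowAt.fderiv_defect (hf : IsFlowAt g u p) {X Y : ℝ × E3 → E3}
    (hX : DifferentiableAt ℝ X p) (hY : DifferentiableAt ℝ Y p)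
    (hframe : ∀ᶠ q in 𝓝 p, IsComplementaryFrame (g q) (u q) (X q) (Y q))
    (hmetric : ∀ v w, g p (u p) v = 0 → g p (u p) w = 0 →
      (shape g u p (X p) (X p) + shape g u p (Y p) (Y p)) * fderiv ℝ g p (1, 0) v w
        = 4 * curvR g u p v w) :
    DifferentiableAt ℝ (fun q => defect g u q (X q) (Y q)) p ∧
    fderiv ℝ (fun q => defect g u q (X q) (Y q)) p (1, u p)
      = - 2 * (shape g u p (X p) (X p) + shape g u p (Y p) (Y p)
            + (fderiv ℝ g p (1, 0) (X p) (X p) + fderiv ℝ g p (1, 0) (Y p) (Y p)) / 4)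
          * ((shape g u p (X p) (X p) - shape g u p (Y p) (Y p)) ^ 2
            + (shape g u p (X p) (Y p) + shape g u p (Y p) (X p)) ^ 2)
        - (2 * (shape g u p (X p) (X p) + shape g u p (Y p) (Y p))
            + (fderiv ℝ g p (1, 0) (X p) (X p) + fderiv ℝ g p (1, 0) (Y p) (Y p)))
          * (shape g u p (X p) (Y p) - shape g u p (Y p) (X p)) ^ 2
        + fderiv ℝ g p (1, 0) (X p) (Y p) * (shape g u p (X p) (X p) - shape g u p (Y p) (Y p))
          * (shape g u p (X p) (Y p) - shape g u p (Y p) (X p))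
        - (fderiv ℝ g p (1, 0) (X p) (X p) - fderiv ℝ g p (1, 0) (Y p) (Y p)) / 2
          * (shape g u p (X p) (Y p) + shape g u p (Y p) (X p))
          * (shape g u p (X p) (Y p) - shape g u p (Y p) (X p)) := by
  have hF := hframe.self_of_nhds
  have hunit : g p (u p) (u p) = 1 := hf.unit.self_of_nhds
  have hu := hf.differentiableAt_field
  obtain ⟨d1, e1⟩ := hf.fderiv_shape hX hX
  obtain ⟨d2, e2⟩ := hf.fderiv_shape hX hY
  obtain ⟨d3, e3⟩ := hf.fderiv_shape hY hX
  obtain ⟨d4, e4⟩ := hf.fderiv_shape hY hY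
  have hD := (((d1.hasFDerivAt.fun_sub d4.hasFDerivAt).pow 2).fun_add
    ((d2.hasFDerivAt.fun_add d3.hasFDerivAt).pow 2)).fun_add
    ((d2.hasFDerivAt.fun_sub d3.hasFDerivAt).pow 2)
  have hD' : HasFDerivAt (fun q => defect g u q (X q) (Y q)) _ p := hD
  refine ⟨hD'.differentiableAt, ?_⟩
  rw [hD'.fderiv]
  obtain ⟨K, k1, k2, k3, k4⟩ := hf.ricci_horizontal hF
  have mXX := hmetric (X p) (X p) hF.orth_uX hF.orth_uX
  have mXY := hmetric (X p) (Y p) hF.orth_uX hF.orth_uY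
  have mYX := hmetric (Y p) (X p) hF.orth_uY hF.orth_uX
  have mYY := hmetric (Y p) (Y p) hF.orth_uY hF.orth_uY
  rw [curvR, hf.mixedCurvature_sym] at mXX mXY mYX mYY
  rw [k1] at mXX
  rw [k3] at mXY
  rw [k4] at mYX
  rw [k2] at mYY
  have cXX := hf.metric_flowDeriv hX hX (hframe.mono fun q hq => hq.norm_X)
  have cXY := hf.metric_flowDeriv hX hY (hframe.mono fun q hq => hq.orth_XY)
  have cYY := hf.metric_flowDeriv hY hY (hframe.mono fun q hq => hq.norm_Y)
  have cuX := hf.metric_flowDeriv hu hX (hframe.mono fun q hq => hq.orth_uX)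
  have cuY := hf.metric_flowDeriv hu hY (hframe.mono fun q hq => hq.orth_uY)
  -- As u is parallel and h(u, ·) = 0, the derivatives of X and Y have no u-component.
  rw [hf.flowDeriv_field, hf.metric_eq, map_zero, zero_apply, zero_add, zero_add, hf.symm p] at cuX cuY
  rw [hf.symm p (X p) (flowDeriv g u X p)] at cXX
  rw [hf.symm p (X p) (flowDeriv g u Y p)] at cXY
  rw [hf.symm p (Y p) (flowDeriv g u Y p)] at cYY
  have aX := hF.expand (hf.symm p) hunit (sliceCov g u p (X p))
  have aY := hF.expand (hf.symm p) hunit (sliceCov g u p (Y p))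
  have lX := hF.expand (hf.symm p) hunit (flowDeriv g u X p)
  have lY := hF.expand (hf.symm p) hunit (flowDeriv g u Y p)
  rw [cuX, zero_smul, zero_add] at lX
  rw [cuY, zero_smul, zero_add] at lY
  have aXu : g p (sliceCov g u p (X p)) (u p) = 0 := hf.shape_field_right (X p)
  have aYu : g p (sliceCov g u p (Y p)) (u p) = 0 := hf.shape_field_right (Y p)
  rw [aXu, zero_smul, zero_add] at aX
  rw [aYu, zero_smul, zero_add] at aY
  have hYX := fderiv_bilin_symm hf.differentiableAt_metric hf.symm (1, 0) (Y p) (X p)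
  rw [← flowDeriv] at e1 e4
  rw [← flowDeriv, ← flowDeriv] at e2 e3
  change sliceCov g u p (X p) = shape g u p (X p) (X p) • X p + shape g u p (X p) (Y p) • Y p at aX
  change sliceCov g u p (Y p) = shape g u p (Y p) (X p) • X p + shape g u p (Y p) (Y p) • Y p at aY
  have sX (w : E3) := congrArg (fun z => shape g u p z w) lX
  have sY (w : E3) := congrArg (fun z => shape g u p z w) lY
  have tX (w : E3) := congrArg (fun z => shape g u p w z) lX
  have tY (w : E3) := congrArg (fun z => shape g u p w z) lY
  simp only [shape_add_left, shape_add_right, shape_smul_left, shape_smul_right] at sX sY tX tY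
  rw [aX] at e1 mXX
  rw [aX, aY] at e2 e3 mXY mYX
  rw [aY] at e4 mYY
  simp only [shape_add_left, shape_smul_left, map_add, map_smul,
    add_apply, smul_apply, smul_eq_mul, hYX, sX, sY, tX, tY] at e1 e2 e3 e4 mXX mXY mYX mYY
  have key := defect_evolution_algebra (K := K)
    (bxx := shape g u p (X p) (X p))
    (rxx := g p (curvature (fun z => g (p.1, z)) p.2 (X p) (u p) (u p)) (X p))
    (nxx := 1 / 2 * (fderiv ℝ (fderiv ℝ g) p (0, u p) (1, 0) (X p) (X p)
      - fderiv ℝ g p (1, 0) (sliceChristoffel g p (u p) (X p)) (X p)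
      - fderiv ℝ g p (1, 0) (X p) (sliceChristoffel g p (u p) (X p))))
    (bxy := shape g u p (X p) (Y p))
    (rxy := g p (curvature (fun z => g (p.1, z)) p.2 (X p) (u p) (u p)) (Y p))
    (nxy := 1 / 2 * (fderiv ℝ (fderiv ℝ g) p (0, u p) (1, 0) (X p) (Y p)
      - fderiv ℝ g p (1, 0) (sliceChristoffel g p (u p) (X p)) (Y p)
      - fderiv ℝ g p (1, 0) (X p) (sliceChristoffel g p (u p) (Y p))))
    (byx := shape g u p (Y p) (X p))
    (ryx := g p (curvature (fun z => g (p.1, z)) p.2 (Y p) (u p) (u p)) (X p))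
    (nyx := 1 / 2 * (fderiv ℝ (fderiv ℝ g) p (0, u p) (1, 0) (Y p) (X p)
      - fderiv ℝ g p (1, 0) (sliceChristoffel g p (u p) (Y p)) (X p)
      - fderiv ℝ g p (1, 0) (Y p) (sliceChristoffel g p (u p) (X p))))
    (byy := shape g u p (Y p) (Y p))
    (ryy := g p (curvature (fun z => g (p.1, z)) p.2 (Y p) (u p) (u p)) (Y p))
    (nyy := 1 / 2 * (fderiv ℝ (fderiv ℝ g) p (0, u p) (1, 0) (Y p) (Y p)
      - fderiv ℝ g p (1, 0) (sliceChristoffel g p (u p) (Y p)) (Y p)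
      - fderiv ℝ g p (1, 0) (Y p) (sliceChristoffel g p (u p) (Y p))))
    cXX cXY cYY (mXX.trans (by ring)) (mXY.trans (by ring))
    (mYX.trans (by ring)) (mYY.trans (by ring)) (e1.trans (by ring)) (e2.trans (by ring))
    (e3.trans (by ring)) (e4.trans (by ring))
  refine Eq.trans ?_ key
  simp only [add_apply, sub_apply, smul_apply, smul_eq_mul, nsmul_eq_mul]
  ring

end NullFlow

/-! ### Regularity of g(∇u, ·), smooth frames and umbilicity. -/

namespace NullFlow

variable {g : ℝ × E3 → E3 →L[ℝ] E3 →L[ℝ] ℝ} {u : ℝ × E3 → E3} {p : ℝ × E3}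

/-- Independent of `IsFlowAt`: continuity of the trace serves to establish `IsFlowAt`, and the
closedness of umbilicity must not presuppose ν ≠ 0. -/
theorem differentiableAt_shape (hg : ContDiffAt ℝ 2 g p) (hu : ContDiffAt ℝ 2 u p)
    (hinv : (g p).IsInvertible) {X Y : ℝ × E3 → E3} (hX : DifferentiableAt ℝ X p)
    (hY : DifferentiableAt ℝ Y p) : DifferentiableAt ℝ (fun q => shape g u q (X q) (Y q)) p := by
  have hg1 := hg.differentiableAt (by norm_num)
  have hu1 := hu.differentiableAt (by norm_num)
  have he : (fun q => shape g u q (X q) (Y q)) =ᶠ[𝓝 p] fun q =>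
      g q (fderiv ℝ u q (0, X q)) (Y q) + (1 / 2) * (fderiv ℝ g q (0, X q) (u q) (Y q)
        + fderiv ℝ g q (0, u q) (X q) (Y q) - fderiv ℝ g q (0, Y q) (X q) (u q)) := by
    filter_upwards [hg.eventually (by simp), hu.eventually (by simp),
      eventually_isInvertible hg1.continuousAt hinv] with q h4 h5 h6
    exact shape_eq (h4.differentiableAt (by norm_num)) (h5.differentiableAt (by norm_num)) h6 _ _
  refine DifferentiableAt.congr_of_eventuallyEq ?_ he
  have h0 {Z : ℝ × E3 → E3} (hZ : DifferentiableAt ℝ Z p) :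
      DifferentiableAt ℝ (fun q => ((0 : ℝ), Z q)) p := (differentiableAt_const _).prodMk hZ
  have h3 {A B C : ℝ × E3 → E3} (hA : DifferentiableAt ℝ A p) (hB : DifferentiableAt ℝ B p)
      (hC : DifferentiableAt ℝ C p) :
      DifferentiableAt ℝ (fun q => fderiv ℝ g q (0, A q) (B q) (C q)) p :=
    (((differentiableAt_fderiv hg).clm_apply (h0 hA)).clm_apply hB).clm_apply hC
  exact ((hg1.clm_apply ((differentiableAt_fderiv hu).clm_apply (h0 hX))).clm_apply hY).fun_add
    ((((h3 hX hu1 hY).fun_add (h3 hu1 hX hY)).fun_sub (h3 hY hX hu1)).const_mul _)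

/-! ### Frames -/

section Frame

variable {b : E3 →L[ℝ] E3 →L[ℝ] ℝ}

theorem exists_notMem_span (S : Finset E3) (hS : S.card < 3) :
    ∃ v, v ∉ Submodule.span ℝ (S : Set E3) := by
  by_contra! h
  have h1 : Submodule.span ℝ (S : Set E3) = ⊤ := Submodule.eq_top_iff'.2 h
  have h2 := finrank_span_finset_le_card (R := ℝ) S
  rw [Set.finrank, h1, finrank_top] at h2
  simp at h2
  omega

/-- Gram-Schmidt, starting from u. -/
theorem exists_isComplementaryFrame (hb : ∀ v w, b v w = b w v) (hpos : ∀ v, v ≠ 0 → 0 < b v v)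
    {u : E3} (hu : b u u = 1) : ∃ X Y, IsComplementaryFrame b u X Y := by
  classical
  have hnorm (v : E3) (hv : v ≠ 0) : b ((√(b v v))⁻¹ • v) ((√(b v v))⁻¹ • v) = 1 := by
    have h1 := hpos v hv
    have h2 : √(b v v) ≠ 0 := (Real.sqrt_pos.2 h1).ne'
    have h3 : b v v = √(b v v) * √(b v v) := (Real.mul_self_sqrt h1.le).symm
    simp only [map_smul, smul_apply, smul_eq_mul]
    rw [mul_comm, mul_assoc]
    nth_rw 2 [h3]
    field_simp
  obtain ⟨v, hv⟩ := exists_notMem_span {u} (by simp)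
  have hv0 : v - b u v • u ≠ 0 := by
    intro h
    apply hv
    rw [sub_eq_zero.1 h]
    exact Submodule.smul_mem _ _ (Submodule.subset_span (by simp))
  set X := (√(b (v - b u v • u) (v - b u v • u)))⁻¹ • (v - b u v • u) with hX
  have hXX : b X X = 1 := hnorm _ hv0
  have huX : b u X = 0 := by
    rw [hX]
    simp [hu]
  obtain ⟨w, hw⟩ := exists_notMem_span {u, X} (lt_of_le_of_lt Finset.card_le_two (by norm_num))
  have hw0 : w - b u w • u - b X w • X ≠ 0 := by
    intro h
    apply hw
    have h1 : w = b u w • u + b X w • X := by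
      rw [sub_sub] at h
      exact sub_eq_zero.1 h
    rw [h1]
    exact Submodule.add_mem _ (Submodule.smul_mem _ _ (Submodule.subset_span (by simp)))
      (Submodule.smul_mem _ _ (Submodule.subset_span (by simp)))
  refine ⟨X, _, hXX, hnorm _ hw0, ?_, huX, ?_⟩
  · simp [hXX, hb X u, huX]
  · simp [hu, huX]

end Frame

/-- An orthonormal frame of `u^⊥` at a point extends smoothly. -/
theorem exists_smooth_frame {n : WithTop ℕ∞} (hg : ContDiffAt ℝ n g p) (hu : ContDiffAt ℝ n u p)
    (hsymm : ∀ q v w, g q v w = g q w v) (hunit : g p (u p) (u p) = 1)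
    {x y : E3} (hxy : IsComplementaryFrame (g p) (u p) x y) :
    ∃ X Y : ℝ × E3 → E3, ContDiffAt ℝ n X p ∧ ContDiffAt ℝ n Y p ∧ X p = x ∧ Y p = y ∧
      ∀ᶠ q in 𝓝 p, IsComplementaryFrame (g q) (u q) (X q) (Y q) := by
  have hgu {A B : ℝ × E3 → E3} (hA : ContDiffAt ℝ n A p) (hB : ContDiffAt ℝ n B p) :
      ContDiffAt ℝ n (fun q => g q (A q) (B q)) p := (hg.clm_apply hA).clm_apply hB
  -- The projection divides by g(u, u): u is known to be a unit vector only at p, while the frame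
  -- must be orthogonal to u on a full neighbourhood, possibly reaching outside I.
  have huu : ContDiffAt ℝ n (fun q => (g q (u q) (u q))⁻¹) p :=
    (hgu hu hu).inv (by rw [hunit]; norm_num)
  have hnormalize {A : ℝ × E3 → E3} (hA : ContDiffAt ℝ n A p) (h1 : g p (A p) (A p) = 1) :
      ContDiffAt ℝ n (fun q => (√(g q (A q) (A q)))⁻¹ • A q) p ∧
      (√(g p (A p) (A p)))⁻¹ • A p = A p ∧
      ∀ᶠ q in 𝓝 p, g q ((√(g q (A q) (A q)))⁻¹ • A q) ((√(g q (A q) (A q)))⁻¹ • A q) = 1 := by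
    refine ⟨?_, by simp [h1], ?_⟩
    · exact (((hgu hA hA).sqrt (by rw [h1]; norm_num)).inv (by rw [h1]; norm_num)).smul hA
    · have h2 : ∀ᶠ q in 𝓝 p, 0 < g q (A q) (A q) :=
        (hgu hA hA).continuousAt.eventually (lt_mem_nhds (by simp only [h1]; norm_num))
      filter_upwards [h2] with q hq
      have h3 : g q (A q) (A q) = √(g q (A q) (A q)) * √(g q (A q) (A q)) :=
        (Real.mul_self_sqrt hq.le).symm
      have h4 : √(g q (A q) (A q)) ≠ 0 := (Real.sqrt_pos.2 hq).ne'
      simp only [map_smul, smul_apply, smul_eq_mul]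
      rw [mul_comm, mul_assoc]
      nth_rw 2 [h3]
      field_simp
  have hnz : ∀ᶠ q in 𝓝 p, g q (u q) (u q) ≠ 0 :=
    (hgu hu hu).continuousAt.eventually_ne (by rw [hunit]; norm_num)
  let X₀ : ℝ × E3 → E3 := fun q => x - ((g q (u q) (u q))⁻¹ * g q (u q) x) • u q
  have hX₀ : ContDiffAt ℝ n X₀ p :=
    contDiffAt_const.sub ((huu.mul (hgu hu contDiffAt_const)).smul hu)
  have hX₀p : X₀ p = x := by simp [X₀, hxy.orth_uX]
  obtain ⟨a1, a2, a3⟩ := hnormalize hX₀ (by rw [hX₀p]; exact hxy.norm_X)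
  rw [hX₀p] at a2
  set X : ℝ × E3 → E3 := fun q => (√(g q (X₀ q) (X₀ q)))⁻¹ • X₀ q with hX
  have hXp : X p = x := by rw [hX]; simp only [hX₀p]; exact a2
  let Y₀ : ℝ × E3 → E3 := fun q =>
    y - ((g q (u q) (u q))⁻¹ * g q (u q) y) • u q - g q (X q) y • X q
  have hY₀ : ContDiffAt ℝ n Y₀ p :=
    (contDiffAt_const.sub ((huu.mul (hgu hu contDiffAt_const)).smul hu)).sub
      ((hgu a1 contDiffAt_const).smul a1)
  have hY₀p : Y₀ p = y := by simp [Y₀, hxy.orth_uY, hXp, hxy.orth_XY]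
  obtain ⟨b1, b2, b3⟩ := hnormalize hY₀ (by rw [hY₀p]; exact hxy.norm_Y)
  rw [hY₀p] at b2
  set Y : ℝ × E3 → E3 := fun q => (√(g q (Y₀ q) (Y₀ q)))⁻¹ • Y₀ q with hY
  have hYp : Y p = y := by rw [hY]; simp only [hY₀p]; exact b2
  refine ⟨X, Y, a1, b1, hXp, hYp, ?_⟩
  filter_upwards [a3, b3, hnz] with q h1 h2 h3
  have huX : g q (u q) (X q) = 0 := by
    simp only [hX, X₀, map_smul, map_sub, smul_eq_mul]
    field_simp
    ring
  refine ⟨h1, h2, ?_, huX, ?_⟩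
  · have h4 : g q (X q) (X q) = 1 := h1
    simp [hY, Y₀, h4, hsymm q (X q) (u q), huX]
  · simp only [hY, Y₀, map_smul, map_sub, smul_eq_mul, huX]
    field_simp
    ring

/-- On `u^⊥` the tensor `g(∇u, ·)` is a multiple of the metric. -/
def IsUmbilicAt (g : ℝ × E3 → E3 →L[ℝ] E3 →L[ℝ] ℝ) (u : ℝ × E3 → E3) (p : ℝ × E3) : Prop :=
  ∃ a : ℝ, ∀ v w, g p (u p) v = 0 → g p (u p) w = 0 → shape g u p v w = a * g p v w

/-- Bilinear forms on the plane u^⊥ have four components; the three squares in `defect` are those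
complementary to the metric. -/
theorem isUmbilicAt_iff_defect (hsymm : ∀ q v w, g q v w = g q w v)
    (hunit : g p (u p) (u p) = 1) {X Y : E3} (h : IsComplementaryFrame (g p) (u p) X Y) :
    IsUmbilicAt g u p ↔ defect g u p X Y = 0 := by
  constructor
  · rintro ⟨a, ha⟩
    rw [defect, ha X X h.orth_uX h.orth_uX, ha X Y h.orth_uX h.orth_uY, ha Y X h.orth_uY h.orth_uX,
      ha Y Y h.orth_uY h.orth_uY, hsymm p Y X, h.orth_XY, h.norm_X, h.norm_Y]
    ring
  · intro hd
    rw [defect] at hd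
    have h1 : shape g u p X X - shape g u p Y Y = 0 := by
      nlinarith [sq_nonneg (shape g u p X X - shape g u p Y Y),
        sq_nonneg (shape g u p X Y + shape g u p Y X), sq_nonneg (shape g u p X Y - shape g u p Y X)]
    have h2 : shape g u p X Y + shape g u p Y X = 0 := by
      nlinarith [sq_nonneg (shape g u p X X - shape g u p Y Y),
        sq_nonneg (shape g u p X Y + shape g u p Y X), sq_nonneg (shape g u p X Y - shape g u p Y X)]
    have h3 : shape g u p X Y - shape g u p Y X = 0 := by
      nlinarith [sq_nonneg (shape g u p X X - shape g u p Y Y),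
        sq_nonneg (shape g u p X Y + shape g u p Y X), sq_nonneg (shape g u p X Y - shape g u p Y X)]
    have h4 : shape g u p X Y = 0 := by linarith
    have h5 : shape g u p Y X = 0 := by linarith
    refine ⟨shape g u p X X, fun v w hv hw => ?_⟩
    have ev := h.expand (hsymm p) hunit v
    have ew := h.expand (hsymm p) hunit w
    rw [hsymm p v (u p), hv, zero_smul, zero_add] at ev
    rw [hsymm p w (u p), hw, zero_smul, zero_add] at ew
    have e1 : shape g u p v w = (g p v X * g p w X + g p v Y * g p w Y) * shape g u p X X := by
      conv_lhs => rw [ev, ew]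
      simp only [shape_add_left, shape_add_right, shape_smul_left, shape_smul_right, h4, h5]
      have h6 : shape g u p Y Y = shape g u p X X := by linarith
      rw [h6]
      ring
    have e2 : g p v w = g p v X * g p w X + g p v Y * g p w Y := by
      conv_lhs => rw [ew]
      simp
      ring
    rw [e1, e2]
    ring

end NullFlow

/-! ### Propagation of umbilicity in a chart by Gronwall's inequality. -/

namespace NullFlow

/-- The evolution equations on the coordinate domain `O`. -/
structure IsLocalFlow (I : Set ℝ) (O : Set E3) (g : ℝ × E3 → E3 →L[ℝ] E3 →L[ℝ] ℝ)
    (u : ℝ × E3 → E3) : Prop where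
  isOpen : IsOpen O
  smooth_metric : ∀ t ∈ I, ∀ y ∈ O, ContDiffAt ℝ 2 g (t, y)
  smooth_field : ∀ t ∈ I, ∀ y ∈ O, ContDiffAt ℝ 2 u (t, y)
  symm : ∀ q v w, g q v w = g q w v
  pos : ∀ t, ∀ y ∈ O, ∀ v, v ≠ 0 → 0 < g (t, y) v v
  unit : ∀ t ∈ I, ∀ y ∈ O, g (t, y) (u (t, y)) (u (t, y)) = 1
  field_eq : ∀ t ∈ I, ∀ y ∈ O, deriv (fun s => u (s, y)) t
    = - cov (fun z => g (t, z)) (fun z => u (t, z)) y (u (t, y))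
  metric_eq : ∀ t ∈ I, ∀ y ∈ O, ∀ X Y : E3, IsComplementaryFrame (g (t, y)) (u (t, y)) X Y →
    nu (fun z => g (t, z)) (fun z => u (t, z)) y X Y ≠ 0 →
    ∀ v w : E3, deriv (fun s => g (s, y) v w) t
      = - (4 / nu (fun z => g (t, z)) (fun z => u (t, z)) y X Y) * curvRPerp g u (t, y) v w

namespace IsLocalFlow

variable {I : Set ℝ} {O : Set E3} {g : ℝ × E3 → E3 →L[ℝ] E3 →L[ℝ] ℝ} {u : ℝ × E3 → E3}
  {p : ℝ × E3}

/-- The metric equation with the denominator cleared: the trace of `shape` on u^⊥ is -ν, which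
absorbs the sign. -/
theorem deriv_metric (h : IsLocalFlow I O g u) (ht : p.1 ∈ I) (hy : p.2 ∈ O) {X Y : E3}
    (hF : IsComplementaryFrame (g p) (u p) X Y) (hν : shape g u p X X + shape g u p Y Y ≠ 0)
    (v w : E3) :
    (shape g u p X X + shape g u p Y Y) * fderiv ℝ g p (1, 0) v w = 4 * curvRPerp g u p v w := by
  have hg := (h.smooth_metric p.1 ht p.2 hy).differentiableAt (by norm_num)
  have h1 := h.metric_eq p.1 ht p.2 hy X Y hF (neg_ne_zero.2 hν) v w
  have h2 := (hg.hasFDerivAt.clm_apply (hasFDerivAt_const v p)).clm_apply (hasFDerivAt_const w p)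
  have h3 := deriv_slice h2.differentiableAt
  rw [fderiv_bilin_apply hg] at h3
  rw [h3] at h1
  have h4 : nu (fun z => g (p.1, z)) (fun z => u (p.1, z)) p.2 X Y
    = -(shape g u p X X + shape g u p Y Y) := rfl
  rw [h1, h4]
  field_simp

/-- The projection in the metric equation removes every u-component; this is the source of h(u, ·) =
0. -/
theorem curvRPerp_field_left (hunit : g p (u p) (u p) = 1) (w : E3) :
    curvRPerp g u p (u p) w = 0 := by
  rw [curvRPerp, hunit]
  ring

theorem isInvertible (h : IsLocalFlow I O g u) (hy : p.2 ∈ O) : (g p).IsInvertible :=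
  isInvertible_of_pos (h.pos p.1 p.2 hy)

/-- A smooth frame makes ν continuous, so ν ≠ 0 persists near p. Hence the metric equation, and with
it h(u, ·) = 0, holds on the slice near p and can be differentiated there. -/
theorem isFlowAt (h : IsLocalFlow I O g u) (ht : p.1 ∈ I) (hy : p.2 ∈ O) {x y : E3}
    (hF : IsComplementaryFrame (g p) (u p) x y) (hν : shape g u p x x + shape g u p y y ≠ 0) :
    IsFlowAt g u p := by
  have hg := h.smooth_metric p.1 ht p.2 hy
  have hu := h.smooth_field p.1 ht p.2 hy
  have hO : ∀ᶠ z in 𝓝 p.2, z ∈ O := h.isOpen.mem_nhds hy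
  obtain ⟨X, Y, hX, hY, rfl, rfl, hXY⟩ := exists_smooth_frame hg hu h.symm (h.unit p.1 ht p.2 hy) hF
  have hX' := hX.differentiableAt (by norm_num)
  have hY' := hY.differentiableAt (by norm_num)
  have hi := h.isInvertible hy
  have hc : ∀ᶠ q in 𝓝 p, shape g u q (X q) (X q) + shape g u q (Y q) (Y q) ≠ 0 :=
    ((differentiableAt_shape hg hu hi hX' hX').continuousAt.add
      (differentiableAt_shape hg hu hi hY' hY').continuousAt).eventually_ne hν
  refine ⟨hg, hu, h.symm, hi, ?_, ?_, ?_⟩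
  · filter_upwards [hO] with z hz
    exact h.unit p.1 ht z hz
  · filter_upwards [hO] with z hz
    rw [← deriv_slice (p := (p.1, z))
      ((h.smooth_field p.1 ht z hz).differentiableAt (by norm_num))]
    exact h.field_eq p.1 ht z hz
  · filter_upwards [hO, (tendsto_slice p).eventually hXY, (tendsto_slice p).eventually hc]
      with z hz h1 h2 w
    have h3 := h.deriv_metric (p := (p.1, z)) ht hz h1 h2 (u (p.1, z)) w
    rw [curvRPerp_field_left (h.unit p.1 ht z hz), mul_zero] at h3
    exact (mul_eq_zero.1 h3).resolve_left h2

theorem deriv_metric_horizontal (h : IsLocalFlow I O g u) (ht : p.1 ∈ I) (hy : p.2 ∈ O) {X Y : E3}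
    (hF : IsComplementaryFrame (g p) (u p) X Y) (hν : shape g u p X X + shape g u p Y Y ≠ 0)
    (v w : E3) (hv : g p (u p) v = 0) (hw : g p (u p) w = 0) :
    (shape g u p X X + shape g u p Y Y) * fderiv ℝ g p (1, 0) v w = 4 * curvR g u p v w := by
  rw [h.deriv_metric ht hy hF hν, curvRPerp, hv, hw]
  ring

/-- The four coefficients are at most 3C, 4C, C and C. The square f3 ^ 2 collects the most, 4C + C +
C. -/
theorem abs_deriv_defect_le {C tr hxx hyy hxy f1 f2 f3 : ℝ} (h1 : |tr| ≤ C) (h2 : |hxx| ≤ C)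
    (h3 : |hyy| ≤ C) (h4 : |hxy| ≤ C) :
    |(-2 * (tr + (hxx + hyy) / 4) * (f1 ^ 2 + f2 ^ 2) - (2 * tr + (hxx + hyy)) * f3 ^ 2
      + hxy * f1 * f3 - (hxx - hyy) / 2 * f2 * f3)| ≤ 6 * C * (f1 ^ 2 + f2 ^ 2 + f3 ^ 2) := by
  have hb {a x K : ℝ} (ha : |a| ≤ K) {y : ℝ} (hx : |x| ≤ y) : |a * x| ≤ K * y := by
    rw [abs_mul]
    exact mul_le_mul ha hx (abs_nonneg _) ((abs_nonneg _).trans ha)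
  have hp (x y : ℝ) : |x * y| ≤ x ^ 2 + y ^ 2 := by
    rw [abs_le]
    constructor <;> nlinarith [sq_nonneg (x - y), sq_nonneg (x + y)]
  have hC : 0 ≤ C := (abs_nonneg _).trans h1
  rw [abs_le] at h1 h2 h3
  have a1 := hb (a := -2 * (tr + (hxx + hyy) / 4)) (K := 3 * C) (x := f1 ^ 2 + f2 ^ 2)
    (abs_le.2 ⟨by linarith, by linarith⟩) (abs_of_nonneg (by positivity)).le
  have a2 := hb (a := 2 * tr + (hxx + hyy)) (K := 4 * C) (x := f3 ^ 2)
    (abs_le.2 ⟨by linarith, by linarith⟩) (abs_of_nonneg (by positivity)).le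
  have a3 := hb h4 (hp f1 f3)
  have a4 := hb (a := (hxx - hyy) / 2) (K := C) (abs_le.2 ⟨by linarith, by linarith⟩) (hp f2 f3)
  rw [abs_le] at a1 a2 a3 a4 ⊢
  have := mul_nonneg hC (sq_nonneg f1)
  have := mul_nonneg hC (sq_nonneg f2)
  have := mul_nonneg hC (sq_nonneg f3)
  constructor <;> nlinarith

/-- Umbilicity propagates forward along the integral curves of `∂_t + u`, as long as `ν ≠ 0`. -/
theorem eventually_isUmbilicAt (h : IsLocalFlow I O g u) {c : ℝ → ℝ × E3} {a b : ℝ} (hab : a < b)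
    (hc : ContinuousOn c (Icc a b)) (hI : ∀ s ∈ Icc a b, (c s).1 ∈ I)
    (hO : ∀ s ∈ Icc a b, (c s).2 ∈ O)
    (hd : ∀ s ∈ Ico a b, HasDerivWithinAt c (1, u (c s)) (Ici s) s)
    (h0 : IsUmbilicAt g u (c a)) {x y : E3} (hF : IsComplementaryFrame (g (c a)) (u (c a)) x y)
    (hν : shape g u (c a) x x + shape g u (c a) y y ≠ 0) :
    ∀ᶠ s in 𝓝[>] a, IsUmbilicAt g u (c s) := by
  have ha : a ∈ Icc a b := left_mem_Icc.2 hab.le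
  have hg := h.smooth_metric _ (hI a ha) _ (hO a ha)
  have hu := h.smooth_field _ (hI a ha) _ (hO a ha)
  have hunit := h.unit _ (hI a ha) _ (hO a ha)
  obtain ⟨X, Y, hX, hY, hXp, hYp, hXY⟩ := exists_smooth_frame hg hu h.symm hunit hF
  rw [← hXp, ← hYp] at hν
  change ContDiffAt ℝ 2 g (c a) at hg
  change ContDiffAt ℝ 2 u (c a) at hu
  change ContDiffAt ℝ 2 X (c a) at hX
  change ContDiffAt ℝ 2 Y (c a) at hY
  have hi := h.isInvertible (hO a ha)
  have hX' := hX.differentiableAt (by norm_num)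
  have hY' := hY.differentiableAt (by norm_num)
  have htr := ((differentiableAt_shape hg hu hi hX' hX').continuousAt.add
      (differentiableAt_shape hg hu hi hY' hY').continuousAt)
  have hh {A B : ℝ × E3 → E3} (hA : DifferentiableAt ℝ A (c a)) (hB : DifferentiableAt ℝ B (c a)) :
      ContinuousAt (fun q => fderiv ℝ g q (1, 0) (A q) (B q)) (c a) :=
    ((((differentiableAt_fderiv hg).clm_apply (differentiableAt_const _)).clm_apply hA).clm_apply
      hB).continuousAt
  have hbdd {f : ℝ × E3 → ℝ} (hf : ContinuousAt f (c a)) :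
      ∀ᶠ q in 𝓝 (c a), |f q| ≤ |f (c a)| + 1 :=
    (hf.abs.eventually (gt_mem_nhds (lt_add_one _))).mono fun q hq => le_of_lt hq
  -- A sum of four bounds, each exceeding its value at `c a` by 1, so one constant serves all
  -- coefficients near `c a`.
  set C := (|shape g u (c a) (X (c a)) (X (c a)) + shape g u (c a) (Y (c a)) (Y (c a))| + 1)
    + (|fderiv ℝ g (c a) (1, 0) (X (c a)) (X (c a))| + 1)
    + (|fderiv ℝ g (c a) (1, 0) (Y (c a)) (Y (c a))| + 1)
    + (|fderiv ℝ g (c a) (1, 0) (X (c a)) (Y (c a))| + 1) with hC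
  have hev : ∀ᶠ q in 𝓝 (c a), IsComplementaryFrame (g q) (u q) (X q) (Y q) ∧
      (∀ᶠ r in 𝓝 q, IsComplementaryFrame (g r) (u r) (X r) (Y r)) ∧
      DifferentiableAt ℝ X q ∧ DifferentiableAt ℝ Y q ∧
      shape g u q (X q) (X q) + shape g u q (Y q) (Y q) ≠ 0 ∧
      |shape g u q (X q) (X q) + shape g u q (Y q) (Y q)| ≤ C ∧
      |fderiv ℝ g q (1, 0) (X q) (X q)| ≤ C ∧ |fderiv ℝ g q (1, 0) (Y q) (Y q)| ≤ C ∧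
      |fderiv ℝ g q (1, 0) (X q) (Y q)| ≤ C := by
    have n1 := abs_nonneg (shape g u (c a) (X (c a)) (X (c a)) + shape g u (c a) (Y (c a)) (Y (c a)))
    have n2 := abs_nonneg (fderiv ℝ g (c a) (1, 0) (X (c a)) (X (c a)))
    have n3 := abs_nonneg (fderiv ℝ g (c a) (1, 0) (Y (c a)) (Y (c a)))
    have n4 := abs_nonneg (fderiv ℝ g (c a) (1, 0) (X (c a)) (Y (c a)))
    filter_upwards [hXY, eventually_eventually_nhds.2 hXY, hX.eventually (by simp),
      hY.eventually (by simp), htr.eventually_ne hν, hbdd htr, hbdd (hh hX' hX'),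
      hbdd (hh hY' hY'), hbdd (hh hX' hY')] with q e1 e2 e3 e4 e5 e6 e7 e8 e9
    simp only [Pi.add_apply] at e6
    exact ⟨e1, e2, e3.differentiableAt (by norm_num), e4.differentiableAt (by norm_num), e5,
      by linarith, by linarith, by linarith, by linarith⟩
  -- The frame, ν ≠ 0 and the bounds are available only near `c a`; the underscore is the
  -- conjunction in `hev`. The estimate is therefore run on a short interval [a, d].
  have hev' : ∀ᶠ s in 𝓝[≥] a, s ∈ Icc a b ∧ c s ∈ {q | _} :=
    (Filter.eventually_of_mem (Icc_mem_nhdsGE hab) fun s hs => hs).and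
      (((hc a ha).mono_of_mem_nhdsWithin (Icc_mem_nhdsGE hab)).eventually hev)
  obtain ⟨d, hd1, hd2⟩ := (mem_nhdsGE_iff_exists_Icc_subset).1 hev'
  have hdefect : ∀ s ∈ Icc a d, DifferentiableAt ℝ (fun q => defect g u q (X q) (Y q)) (c s) ∧
      |fderiv ℝ (fun q => defect g u q (X q) (Y q)) (c s) (1, u (c s))|
        ≤ 6 * C * defect g u (c s) (X (c s)) (Y (c s)) := by
    intro s hs
    obtain ⟨hs1, e1, e2, e3, e4, e5, e6, e7, e8, e9⟩ := hd2 hs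
    obtain ⟨k1, k2⟩ := (h.isFlowAt (hI s hs1) (hO s hs1) e1 e5).fderiv_defect e3 e4 e2
      (h.deriv_metric_horizontal (hI s hs1) (hO s hs1) e1 e5)
    refine ⟨k1, ?_⟩
    rw [k2]
    exact abs_deriv_defect_le e6 e7 e8 e9
  have hzero : ∀ s ∈ Icc a d, defect g u (c s) (X (c s)) (Y (c s)) = 0 := by
    intro s hs
    -- Zero initial value and zero inhomogeneity: the bound is identically 0.
    have hgr := norm_le_gronwallBound_of_norm_deriv_right_le (δ := 0) (K := 6 * C) (ε := 0)
      (f := fun s => defect g u (c s) (X (c s)) (Y (c s)))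
      (f' := fun s => fderiv ℝ (fun q => defect g u q (X q) (Y q)) (c s) (1, u (c s)))
      (a := a) (b := d) ?_ ?_ ?_ ?_ s hs
    · rw [gronwallBound_ε0_δ0] at hgr
      exact norm_le_zero_iff.1 hgr
    · intro r hr
      have h1 := (hc r (hd2 hr).1).mono (show Icc a d ⊆ Icc a b from fun q hq => (hd2 hq).1)
      exact (hdefect r hr).1.continuousAt.comp_continuousWithinAt h1
    · intro r hr
      have hr' : r ∈ Icc a d := Ico_subset_Icc_self hr
      have hdb : d ≤ b := (hd2 (right_mem_Icc.2 (le_of_lt hd1))).1.2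
      exact (hdefect r hr').1.hasFDerivAt.comp_hasDerivWithinAt r
        (hd r ⟨hr.1, hr.2.trans_le hdb⟩)
    · have h1 : IsComplementaryFrame (g (c a)) (u (c a)) (X (c a)) (Y (c a)) := hXY.self_of_nhds
      rw [(isUmbilicAt_iff_defect h.symm hunit h1).1 h0]
      simp
    · intro r hr
      have := (hdefect r (Ico_subset_Icc_self hr)).2
      rw [add_zero, Real.norm_eq_abs, Real.norm_eq_abs, abs_of_nonneg (defect_nonneg _ _)]
      exact this
  filter_upwards [Ioc_mem_nhdsGT hd1] with s hs
  have hs' := Ioc_subset_Icc_self hs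
  obtain ⟨hs1, e1, -⟩ := hd2 hs'
  exact (isUmbilicAt_iff_defect h.symm (h.unit _ (hI s hs1) _ (hO s hs1)) e1).2 (hzero s hs')

/-- Umbilicity is a closed condition along curves. -/
theorem isUmbilicAt_of_tendsto (h : IsLocalFlow I O g u) (ht : p.1 ∈ I) (hy : p.2 ∈ O)
    {c : ℝ → ℝ × E3} {l : Filter ℝ} [l.NeBot] (hc : Filter.Tendsto c l (𝓝 p))
    (hI : ∀ᶠ s in l, (c s).1 ∈ I) (hu : ∀ᶠ s in l, IsUmbilicAt g u (c s)) :
    IsUmbilicAt g u p := by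
  have hg := h.smooth_metric _ ht _ hy
  have hu' := h.smooth_field _ ht _ hy
  have hunit := h.unit _ ht _ hy
  obtain ⟨x, y, hF⟩ := exists_isComplementaryFrame (h.symm p) (h.pos p.1 p.2 hy) hunit
  obtain ⟨X, Y, hX, hY, rfl, rfl, hXY⟩ := exists_smooth_frame hg hu' h.symm hunit hF
  have hi := h.isInvertible hy
  have hX' := hX.differentiableAt (by norm_num)
  have hY' := hY.differentiableAt (by norm_num)
  have hs {A B : ℝ × E3 → E3} (hA : DifferentiableAt ℝ A p) (hB : DifferentiableAt ℝ B p) :=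
    differentiableAt_shape hg hu' hi hA hB
  have hdef : ContinuousAt (fun q => defect g u q (X q) (Y q)) p :=
    ((((hs hX' hX').fun_sub (hs hY' hY')).fun_pow 2).fun_add
      (((hs hX' hY').fun_add (hs hY' hX')).fun_pow 2)).fun_add
      (((hs hX' hY').fun_sub (hs hY' hX')).fun_pow 2) |>.continuousAt
  rw [isUmbilicAt_iff_defect h.symm hunit hXY.self_of_nhds]
  -- The defect in a frame continuous at p has limit its value at p, and is 0 along the filter.
  refine tendsto_nhds_unique (hdef.tendsto.comp hc) (tendsto_const_nhds.congr' ?_)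
  have hO : ∀ᶠ q : ℝ × E3 in 𝓝 p, q.2 ∈ O :=
    continuousAt_snd.eventually (h.isOpen.mem_nhds hy)
  filter_upwards [hI, hu, hc.eventually hXY, hc.eventually hO] with s h1 h2 h3 h4
  exact ((isUmbilicAt_iff_defect h.symm (h.unit _ h1 _ h4) h3).1 h2).symm

end IsLocalFlow

end NullFlow

/-! ### Brackets in terms of the connection, and transport of vector fields through charts. -/

namespace NullFlow

section Brackets

variable {F : Type*} [NormedAddCommGroup F] [NormedSpace ℝ F]
  {G : F → F →L[ℝ] F →L[ℝ] ℝ} {W X Y : F → F} {p : F}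

/-- The Lie derivative of a metric in terms of the Levi-Civita connection. -/
theorem lieDeriv_eq_cov (hG : DifferentiableAt ℝ G p) (hsymm : ∀ q v w, G q v w = G q w v)
    (hinv : (G p).IsInvertible)
    (hX : DifferentiableAt ℝ X p) (hY : DifferentiableAt ℝ Y p) :
    fderiv ℝ (fun z => G z (X z) (Y z)) p (W p) - G p (VectorField.lieBracket ℝ W X p) (Y p)
        - G p (X p) (VectorField.lieBracket ℝ W Y p)
      = G p (cov G W p (X p)) (Y p) + G p (cov G W p (Y p)) (X p) := by
  rw [((hG.hasFDerivAt.clm_apply hX.hasFDerivAt).clm_apply hY.hasFDerivAt).fderiv]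
  simp only [VectorField.lieBracket, cov, map_add, map_sub, add_apply, sub_apply,
    ContinuousLinearMap.comp_apply, ContinuousLinearMap.flip_apply, apply_christoffel G p _ _ _ hinv]
  have h1 := fderiv_bilin_symm hG hsymm (W p) (X p) (Y p)
  have h2 := fderiv_bilin_symm hG hsymm (X p) (W p) (Y p)
  have h3 := fderiv_bilin_symm hG hsymm (Y p) (W p) (X p)
  have h4 := hsymm p (X p) (fderiv ℝ W p (Y p))
  linarith

/-- The Lie bracket of fields orthogonal to `W`, in terms of the Levi-Civita connection. -/
theorem inner_lieBracket_eq_cov (hG : DifferentiableAt ℝ G p)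
    (hsymm : ∀ q v w, G q v w = G q w v) (hinv : (G p).IsInvertible)
    (hW : DifferentiableAt ℝ W p) (hX : DifferentiableAt ℝ X p) (hY : DifferentiableAt ℝ Y p)
    (hWX : ∀ᶠ q in 𝓝 p, G q (W q) (X q) = 0) (hWY : ∀ᶠ q in 𝓝 p, G q (W q) (Y q) = 0) :
    G p (W p) (VectorField.lieBracket ℝ X Y p)
      = G p (cov G W p (Y p)) (X p) - G p (cov G W p (X p)) (Y p) := by
  -- Differentiated orthogonality shifts the derivative from the horizontal field onto W.
  have key {Z : F → F} (hZ : DifferentiableAt ℝ Z p) (h : ∀ᶠ q in 𝓝 p, G q (W q) (Z q) = 0)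
      (v : F) : fderiv ℝ G p v (W p) (Z p) + G p (fderiv ℝ W p v) (Z p)
        + G p (W p) (fderiv ℝ Z p v) = 0 := by
    have h1 := (hG.hasFDerivAt.clm_apply hW.hasFDerivAt).clm_apply hZ.hasFDerivAt
    have h2 : (fun q => G q (W q) (Z q)) =ᶠ[𝓝 p] fun _ => 0 := h
    have h3 := congrArg (fun L : F →L[ℝ] ℝ => L v) h1.fderiv
    rw [h2.fderiv_eq] at h3
    simp at h3
    linarith
  have k1 := key hX hWX (Y p)
  have k2 := key hY hWY (X p)
  simp only [VectorField.lieBracket, cov, map_add, map_sub, add_apply,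
    apply_christoffel G p _ _ _ hinv]
  have h1 := fderiv_bilin_symm hG hsymm (W p) (X p) (Y p)
  have h2 := fderiv_bilin_symm hG hsymm (X p) (W p) (Y p)
  have h3 := fderiv_bilin_symm hG hsymm (Y p) (W p) (X p)
  linarith

end Brackets

section Charts

variable {M : Type*} [TopologicalSpace M] [ChartedSpace E3 M] {φ : OpenPartialHomeomorph M E3}

theorem mdifferentiable_of_mem_maximalAtlas (hφ : φ ∈ IsManifold.maximalAtlas (𝓡 3) ∞ M) :
    φ.MDifferentiable (𝓡 3) (𝓡 3) :=
  ⟨(contMDiffOn_of_mem_maximalAtlas hφ).mdifferentiableOn (by simp),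
    (contMDiffOn_symm_of_mem_maximalAtlas hφ).mdifferentiableOn (by simp)⟩

/-- The vector field `W` read in the chart `φ`. -/
def pushField (φ : OpenPartialHomeomorph M E3) (W : (x : M) → TangentSpace (𝓡 3) x) (y : E3) : E3 :=
  mfderiv (𝓡 3) (𝓡 3) φ (φ.symm y) (W (φ.symm y))

theorem mfderiv_symm_pushField (hφ : φ ∈ IsManifold.maximalAtlas (𝓡 3) ∞ M)
    (W : (x : M) → TangentSpace (𝓡 3) x) {y : E3} (hy : y ∈ φ.target) :
    mfderiv (𝓡 3) (𝓡 3) φ.symm y (pushField φ W y) = W (φ.symm y) := by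
  have h := (mdifferentiable_of_mem_maximalAtlas hφ).symm_comp_deriv (φ.map_target hy)
  rw [φ.right_inv hy] at h
  exact congrArg (fun L : TangentSpace (𝓡 3) (φ.symm y) →L[ℝ] TangentSpace (𝓡 3) (φ.symm y) =>
    L (W (φ.symm y))) h

theorem isInvertible_mfderiv_symm (hφ : φ ∈ IsManifold.maximalAtlas (𝓡 3) ∞ M) {y : E3}
    (hy : y ∈ φ.target) : (mfderiv (𝓡 3) (𝓡 3) φ.symm y).IsInvertible := by
  have h1 := (mdifferentiable_of_mem_maximalAtlas hφ).symm_comp_deriv (φ.map_target hy)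
  rw [φ.right_inv hy] at h1
  exact ContinuousLinearMap.IsInvertible.of_inverse h1
    ((mdifferentiable_of_mem_maximalAtlas hφ).comp_symm_deriv hy)

theorem isInvertible_mfderiv_chart (hφ : φ ∈ IsManifold.maximalAtlas (𝓡 3) ∞ M) {x : M}
    (hx : x ∈ φ.source) : (mfderiv (𝓡 3) (𝓡 3) φ x).IsInvertible := by
  have h2 := (mdifferentiable_of_mem_maximalAtlas hφ).comp_symm_deriv (φ.map_source hx)
  rw [φ.left_inv hx] at h2
  exact ContinuousLinearMap.IsInvertible.of_inverse h2
    ((mdifferentiable_of_mem_maximalAtlas hφ).symm_comp_deriv hx)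

/-- Pushing forward by φ is pulling back by its inverse; this gives access to smoothness and bracket
naturality of `mpullback`. -/
theorem mpullback_symm_eq_pushField (hφ : φ ∈ IsManifold.maximalAtlas (𝓡 3) ∞ M)
    (W : (x : M) → TangentSpace (𝓡 3) x) {y : E3} (hy : y ∈ φ.target) :
    VectorField.mpullback (𝓡 3) (𝓡 3) φ.symm W y = pushField φ W y := by
  rw [VectorField.mpullback_apply, ← mfderiv_symm_pushField hφ W hy]
  exact (isInvertible_mfderiv_symm hφ hy).inverse_apply_self _

theorem metricIn_pushField (hφ : φ ∈ IsManifold.maximalAtlas (𝓡 3) ∞ M)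
    (g : ℝ → Bundle.RiemannianMetric (fun x : M => TangentSpace (𝓡 3) x)) (t : ℝ)
    (W V : (x : M) → TangentSpace (𝓡 3) x) {y : E3} (hy : y ∈ φ.target) :
    metricIn g φ (t, y) (pushField φ W y) (pushField φ V y)
      = (g t).inner (φ.symm y) (W (φ.symm y)) (V (φ.symm y)) := by
  have h1 := mfderiv_symm_pushField hφ W hy
  have h2 := mfderiv_symm_pushField hφ V hy
  rw [← h1, ← h2]
  rfl

theorem contDiffAt_pushField [IsManifold (𝓡 3) ∞ M] (hφ : φ ∈ IsManifold.maximalAtlas (𝓡 3) ∞ M)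
    {W : (x : M) → TangentSpace (𝓡 3) x} {x : M} (hx : x ∈ φ.source)
    (hW : ContMDiffAt (𝓡 3) (𝓡 3).tangent ∞ (fun z => (⟨z, W z⟩ : TangentBundle (𝓡 3) M)) x) :
    ContDiffAt ℝ ∞ (pushField φ W) (φ x) := by
  have hy := φ.map_source hx
  have h1 : ContMDiffAt (𝓡 3) (𝓡 3) ∞ φ.symm (φ x) :=
    (contMDiffOn_symm_of_mem_maximalAtlas hφ).contMDiffAt (φ.open_target.mem_nhds hy)
  have h2 := ContMDiffAt.mpullback_vectorField_preimage (m := ∞) (n := ∞) (f := φ.symm)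
    (x₀ := φ x) (V := W) (by rwa [φ.left_inv hx]) h1 (isInvertible_mfderiv_symm hφ hy) (by simp)
  rw [contMDiffAt_vectorSpace_iff_contDiffAt] at h2
  refine h2.congr_of_eventuallyEq ?_
  filter_upwards [φ.open_target.mem_nhds hy] with z hz
  exact (mpullback_symm_eq_pushField hφ W hz).symm

/-- The vector field on `M` given in the chart `φ` by `w`. -/
def pullField (φ : OpenPartialHomeomorph M E3) (w : E3 → E3) (x : M) : TangentSpace (𝓡 3) x :=
  VectorField.mpullback (𝓡 3) (𝓡 3) φ (fun y => (w y : TangentSpace (𝓡 3) y)) x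

theorem contMDiffAt_pullField [IsManifold (𝓡 3) ∞ M] (hφ : φ ∈ IsManifold.maximalAtlas (𝓡 3) ∞ M)
    {w : E3 → E3} {x : M} (hx : x ∈ φ.source) (hw : ContDiffAt ℝ ∞ w (φ x)) :
    ContMDiffAt (𝓡 3) (𝓡 3).tangent ∞
      (fun z => (⟨z, pullField φ w z⟩ : TangentBundle (𝓡 3) M)) x :=
  ContMDiffAt.mpullback_vectorField_preimage (m := ∞) (n := ∞)
    (contMDiffAt_vectorSpace_iff_contDiffAt.2 hw)
    ((contMDiffOn_of_mem_maximalAtlas hφ).contMDiffAt (φ.open_source.mem_nhds hx))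
    (isInvertible_mfderiv_chart hφ hx) (by simp)

theorem pushField_pullField (hφ : φ ∈ IsManifold.maximalAtlas (𝓡 3) ∞ M) (w : E3 → E3) {y : E3}
    (hy : y ∈ φ.target) : pushField φ (pullField φ w) y = w y := by
  have h := (isInvertible_mfderiv_chart hφ (φ.map_target hy)).self_apply_inverse
    (w (φ (φ.symm y)))
  exact h.trans (congrArg w (φ.right_inv hy))

theorem pullField_pushField (hφ : φ ∈ IsManifold.maximalAtlas (𝓡 3) ∞ M)
    (W : (x : M) → TangentSpace (𝓡 3) x) {x : M} (hx : x ∈ φ.source) :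
    pullField φ (pushField φ W) x = W x := by
  have h := (isInvertible_mfderiv_chart hφ hx).inverse_apply_self (W x)
  refine Eq.trans ?_ h
  change (mfderiv (𝓡 3) (𝓡 3) φ x).inverse (pushField φ W (φ x)) = _
  rw [pushField, φ.left_inv hx]

theorem contMDiffAt_of_pushField [IsManifold (𝓡 3) ∞ M] (hφ : φ ∈ IsManifold.maximalAtlas (𝓡 3) ∞ M)
    {W : (x : M) → TangentSpace (𝓡 3) x} {x : M} (hx : x ∈ φ.source)
    (hW : ContDiffAt ℝ ∞ (pushField φ W) (φ x)) :
    ContMDiffAt (𝓡 3) (𝓡 3).tangent ∞ (fun z => (⟨z, W z⟩ : TangentBundle (𝓡 3) M)) x := by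
  refine (contMDiffAt_pullField hφ hx hW).congr_of_eventuallyEq ?_
  filter_upwards [φ.open_source.mem_nhds hx] with z hz
  rw [pullField_pushField hφ W hz]

theorem pushField_mlieBracket [IsManifold (𝓡 3) ∞ M] (hφ : φ ∈ IsManifold.maximalAtlas (𝓡 3) ∞ M)
    {W V : (x : M) → TangentSpace (𝓡 3) x} {x : M} (hx : x ∈ φ.source)
    (hW : ContMDiffAt (𝓡 3) (𝓡 3).tangent ∞ (fun z => (⟨z, W z⟩ : TangentBundle (𝓡 3) M)) x)
    (hV : ContMDiffAt (𝓡 3) (𝓡 3).tangent ∞ (fun z => (⟨z, V z⟩ : TangentBundle (𝓡 3) M)) x) :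
    pushField φ (VectorField.mlieBracket (𝓡 3) W V) (φ x)
      = VectorField.lieBracket ℝ (pushField φ W) (pushField φ V) (φ x) := by
  have hy := φ.map_source hx
  have : IsManifold (𝓡 3) (minSmoothness ℝ 2) M := by
    simp only [minSmoothness_of_isRCLikeNormedField]
    infer_instance
  have h1 : ContMDiffAt (𝓡 3) (𝓡 3) ∞ φ.symm (φ x) :=
    (contMDiffOn_symm_of_mem_maximalAtlas hφ).contMDiffAt (φ.open_target.mem_nhds hy)
  have h2 := VectorField.mpullback_mlieBracket (n := ∞) (f := φ.symm) (x₀ := φ x) (V := W) (W := V)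
    (by rw [φ.left_inv hx]; exact hW.mdifferentiableAt (by simp))
    (by rw [φ.left_inv hx]; exact hV.mdifferentiableAt (by simp)) h1
    (by simp only [minSmoothness_of_isRCLikeNormedField]; exact ENat.LEInfty.out)
  rw [mpullback_symm_eq_pushField hφ _ hy] at h2
  rw [h2]
  have e (Z : (x : M) → TangentSpace (𝓡 3) x) :
      VectorField.mpullback (𝓡 3) (𝓡 3) φ.symm Z =ᶠ[𝓝 (φ x)] pushField φ Z := by
    filter_upwards [φ.open_target.mem_nhds hy] with z hz
    exact mpullback_symm_eq_pushField hφ Z hz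
  rw [← VectorField.mlieBracketWithin_univ, VectorField.mlieBracketWithin_eq_lieBracketWithin]
  exact (congrFun VectorField.lieBracketWithin_univ (φ x)).trans <| (e W).lieBracket_vectorField_eq (e V)

end Charts

end NullFlow

/-! ### Conformality and integrability as umbilicity in a chart. -/

namespace NullFlow

variable {M : Type*} [TopologicalSpace M] [ChartedSpace E3 M] {φ : OpenPartialHomeomorph M E3}
  {I : Set ℝ} {g : ℝ → Bundle.RiemannianMetric (fun x : M => TangentSpace (𝓡 3) x)}
  {U : ℝ → (x : M) → TangentSpace (𝓡 3) x}

theorem isLocalFlow_chart (htriple : IsEvolvingTriple I g U) (hflow : IsModifiedRicciFlow I g U)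
    (hφ : φ ∈ IsManifold.maximalAtlas (𝓡 3) ∞ M) :
    IsLocalFlow I φ.target (metricIn g φ) (fieldIn U φ) where
  isOpen := φ.open_target
  smooth_metric t ht y hy := (htriple.smooth_metric φ hφ t ht y hy).of_le ENat.LEInfty.out
  smooth_field t ht y hy := (htriple.smooth_field φ hφ t ht y hy).of_le ENat.LEInfty.out
  symm q v w := (g q.1).symm (φ.symm q.2) _ _
  pos t y hy v hv := by
    refine (g t).pos (φ.symm y) (mfderiv (𝓡 3) (𝓡 3) φ.symm y v) fun h => hv ?_
    obtain ⟨e, he⟩ := isInvertible_mfderiv_symm hφ hy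
    rw [← he] at h
    exact e.injective (h.trans (map_zero e).symm)
  unit t ht y hy := (metricIn_pushField hφ g t (U t) (U t) hy).trans (htriple.unit t ht _)
  field_eq := hflow.field_eq φ hφ
  metric_eq := hflow.metric_eq φ hφ

theorem pushField_apply (W : (x : M) → TangentSpace (𝓡 3) x) {x : M} (hx : x ∈ φ.source) :
    pushField φ W (φ x) = mfderiv (𝓡 3) (𝓡 3) φ x (W x) := by
  rw [pushField, φ.left_inv hx]

theorem inner_eq_metricIn (hφ : φ ∈ IsManifold.maximalAtlas (𝓡 3) ∞ M) (t : ℝ)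
    (W V : (x : M) → TangentSpace (𝓡 3) x) {x : M} (hx : x ∈ φ.source) :
    (g t).inner x (W x) (V x) = metricIn g φ (t, φ x) (pushField φ W (φ x)) (pushField φ V (φ x)) := by
  rw [metricIn_pushField hφ g t W V (φ.map_source hx), φ.left_inv hx]

/-- At the point `x` the foliation tangent to `U` is conformal and `U^⊥` is integrable. -/
def IsConformalIntegrableAt (g : Bundle.RiemannianMetric (fun x : M => TangentSpace (𝓡 3) x))
    (U : (x : M) → TangentSpace (𝓡 3) x) (x : M) [IsManifold (𝓡 3) ∞ M] : Prop :=
  (∃ a : ℝ, ∀ X Y : (x : M) → TangentSpace (𝓡 3) x,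
    IsHorizontalNear g U X x → IsHorizontalNear g U Y x →
      lieDerivMetric g U X Y x = a * g.inner x (X x) (Y x)) ∧
  ∀ X Y : (x : M) → TangentSpace (𝓡 3) x,
    IsHorizontalNear g U X x → IsHorizontalNear g U Y x →
      g.inner x (U x) (VectorField.mlieBracket (𝓡 3) X Y x) = 0

theorem contDiffAt_pushField_field (htriple : IsEvolvingTriple I g U)
    (hφ : φ ∈ IsManifold.maximalAtlas (𝓡 3) ∞ M) {t : ℝ} (ht : t ∈ I) {x : M} (hx : x ∈ φ.source) :
    ContDiffAt ℝ ∞ (pushField φ (U t)) (φ x) :=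
  contDiffAt_slice (p := (t, φ x)) (htriple.smooth_field φ hφ t ht _ (φ.map_source hx))

section Smooth

variable [IsManifold (𝓡 3) ∞ M]

theorem lieDerivMetric_eq_shape (htriple : IsEvolvingTriple I g U)
    (hflow : IsModifiedRicciFlow I g U)
    (hφ : φ ∈ IsManifold.maximalAtlas (𝓡 3) ∞ M) {t : ℝ} (ht : t ∈ I) {x : M} (hx : x ∈ φ.source)
    {X Y : (x : M) → TangentSpace (𝓡 3) x}
    (hX : IsHorizontalNear (g t) (U t) X x) (hY : IsHorizontalNear (g t) (U t) Y x) :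
    lieDerivMetric (g t) (U t) X Y x
      = shape (metricIn g φ) (fieldIn U φ) (t, φ x) (pushField φ X (φ x)) (pushField φ Y (φ x))
        + shape (metricIn g φ) (fieldIn U φ) (t, φ x) (pushField φ Y (φ x)) (pushField φ X (φ x)) := by
  have hL := isLocalFlow_chart htriple hflow hφ
  have hy := φ.map_source hx
  have hG : DifferentiableAt ℝ (fun z => metricIn g φ (t, z)) (φ x) :=
    (contDiffAt_slice (p := (t, φ x)) (hL.smooth_metric t ht _ hy)).differentiableAt
      (by norm_num)
  have hU := contDiffAt_pushField_field htriple hφ ht hx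
  have hU' := contMDiffAt_of_pushField hφ hx hU
  have hX' := (contDiffAt_pushField hφ hx hX.1).differentiableAt (by simp)
  have hY' := (contDiffAt_pushField hφ hx hY.1).differentiableAt (by simp)
  have key := lieDeriv_eq_cov (W := pushField φ (U t)) hG (fun z => hL.symm (t, z))
    (hL.isInvertible (p := (t, φ x)) hy) hX' hY'
  refine Eq.trans ?_ key
  rw [lieDerivMetric, inner_eq_metricIn hφ t (VectorField.mlieBracket (𝓡 3) (U t) X) Y hx,
    inner_eq_metricIn hφ t X (VectorField.mlieBracket (𝓡 3) (U t) Y) hx,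
    pushField_mlieBracket hφ hx hU' hX.1, pushField_mlieBracket hφ hx hU' hY.1]
  congr 2
  have hF := ((hG.clm_apply hX').clm_apply hY').hasFDerivAt.hasMFDerivAt.comp x
    ((mdifferentiable_of_mem_maximalAtlas hφ).mdifferentiableAt hx).hasMFDerivAt
  have he : (fun z => (g t).inner z (X z) (Y z)) =ᶠ[𝓝 x]
      (fun y => metricIn g φ (t, y) (pushField φ X y) (pushField φ Y y)) ∘ φ := by
    filter_upwards [φ.open_source.mem_nhds hx] with z hz
    exact inner_eq_metricIn hφ t X Y hz
  have h1 := (hF.congr_of_eventuallyEq he).mfderiv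
  rw [pushField_apply _ hx]
  exact congrArg (fun L : E3 →L[ℝ] ℝ => L (U t x)) h1

theorem inner_mlieBracket_eq_shape (htriple : IsEvolvingTriple I g U)
    (hflow : IsModifiedRicciFlow I g U)
    (hφ : φ ∈ IsManifold.maximalAtlas (𝓡 3) ∞ M) {t : ℝ} (ht : t ∈ I) {x : M} (hx : x ∈ φ.source)
    {X Y : (x : M) → TangentSpace (𝓡 3) x}
    (hX : IsHorizontalNear (g t) (U t) X x) (hY : IsHorizontalNear (g t) (U t) Y x) :
    (g t).inner x (U t x) (VectorField.mlieBracket (𝓡 3) X Y x)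
      = shape (metricIn g φ) (fieldIn U φ) (t, φ x) (pushField φ Y (φ x)) (pushField φ X (φ x))
        - shape (metricIn g φ) (fieldIn U φ) (t, φ x) (pushField φ X (φ x)) (pushField φ Y (φ x)) := by
  have hL := isLocalFlow_chart htriple hflow hφ
  have hy := φ.map_source hx
  have hG : DifferentiableAt ℝ (fun z => metricIn g φ (t, z)) (φ x) :=
    (contDiffAt_slice (p := (t, φ x)) (hL.smooth_metric t ht _ hy)).differentiableAt
      (by norm_num)
  have hU := contDiffAt_pushField_field htriple hφ ht hx
  have hX' := (contDiffAt_pushField hφ hx hX.1).differentiableAt (by simp)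
  have hY' := (contDiffAt_pushField hφ hx hY.1).differentiableAt (by simp)
  have horth {Z : (x : M) → TangentSpace (𝓡 3) x} (hZ : IsHorizontalNear (g t) (U t) Z x) :
      ∀ᶠ y in 𝓝 (φ x), metricIn g φ (t, y) (pushField φ (U t) y) (pushField φ Z y) = 0 := by
    have h1 : Filter.Tendsto φ.symm (𝓝 (φ x)) (𝓝 x) := by
      simpa [φ.left_inv hx] using (φ.continuousAt_symm hy).tendsto
    filter_upwards [h1.eventually hZ.2, φ.open_target.mem_nhds hy] with y h2 h3
    rw [metricIn_pushField hφ g t _ _ h3]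
    exact h2
  have key := inner_lieBracket_eq_cov (W := pushField φ (U t)) hG (fun z => hL.symm (t, z))
    (hL.isInvertible (p := (t, φ x)) hy) (hU.differentiableAt (by simp)) hX' hY' (horth hX)
    (horth hY)
  refine Eq.trans ?_ key
  rw [inner_eq_metricIn hφ t (U t) (VectorField.mlieBracket (𝓡 3) X Y) hx,
    pushField_mlieBracket hφ hx hX.1 hY.1]

/-- A vector orthogonal to `U` extends to a smooth field orthogonal to `U`. -/
theorem exists_isHorizontalNear (htriple : IsEvolvingTriple I g U)
    (hφ : φ ∈ IsManifold.maximalAtlas (𝓡 3) ∞ M) {t : ℝ} (ht : t ∈ I) {x : M} (hx : x ∈ φ.source)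
    {v : E3} (hv : metricIn g φ (t, φ x) (fieldIn U φ (t, φ x)) v = 0) :
    ∃ X, IsHorizontalNear (g t) (U t) X x ∧ pushField φ X (φ x) = v := by
  have hy := φ.map_source hx
  have hG := contDiffAt_slice (p := (t, φ x)) (htriple.smooth_metric φ hφ t ht _ hy)
  have hU := contDiffAt_pushField_field htriple hφ ht hx
  have hunit {z : M} (hz : z ∈ φ.source) :
      metricIn g φ (t, φ z) (pushField φ (U t) (φ z)) (pushField φ (U t) (φ z)) = 1 := by
    rw [← inner_eq_metricIn hφ t _ _ hz]
    exact htriple.unit t ht z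
  let w : E3 → E3 := fun y =>
    v - metricIn g φ (t, y) (pushField φ (U t) y) v • pushField φ (U t) y
  have hw : ContDiffAt ℝ ∞ w (φ x) :=
    contDiffAt_const.sub (((hG.clm_apply hU).clm_apply contDiffAt_const).smul hU)
  refine ⟨pullField φ w, ⟨contMDiffAt_pullField hφ hx hw, ?_⟩, ?_⟩
  · filter_upwards [φ.open_source.mem_nhds hx] with z hz
    rw [inner_eq_metricIn hφ t _ _ hz, pushField_pullField hφ w (φ.map_source hz)]
    simp only [w, map_sub, map_smul, hunit hz, smul_eq_mul, mul_one, sub_self]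
  · rw [pushField_pullField hφ w hy]
    change v - metricIn g φ (t, φ x) (fieldIn U φ (t, φ x)) v • _ = v
    rw [hv, zero_smul, sub_zero]

/-- The Lie derivative is twice the symmetric part of `shape` and the bracket gives its
antisymmetric part. Every horizontal vector extends to a horizontal field, so statements on fields
and on vectors agree; the conformal factor is twice the umbilicity factor. -/
theorem isConformalIntegrableAt_iff (htriple : IsEvolvingTriple I g U)
    (hflow : IsModifiedRicciFlow I g U)
    (hφ : φ ∈ IsManifold.maximalAtlas (𝓡 3) ∞ M) {t : ℝ} (ht : t ∈ I) {x : M}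
    (hx : x ∈ φ.source) :
    IsConformalIntegrableAt (g t) (U t) x
      ↔ IsUmbilicAt (metricIn g φ) (fieldIn U φ) (t, φ x) := by
  constructor
  · rintro ⟨⟨a, ha⟩, hi⟩
    refine ⟨a / 2, fun v w hv hw => ?_⟩
    obtain ⟨X, hX, rfl⟩ := exists_isHorizontalNear htriple hφ ht hx hv
    obtain ⟨Y, hY, rfl⟩ := exists_isHorizontalNear htriple hφ ht hx hw
    have h1 := ha X Y hX hY
    have h2 := hi X Y hX hY
    rw [lieDerivMetric_eq_shape htriple hflow hφ ht hx hX hY, inner_eq_metricIn hφ t _ _ hx] at h1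
    rw [inner_mlieBracket_eq_shape htriple hflow hφ ht hx hX hY] at h2
    linarith
  · rintro ⟨a, ha⟩
    have horth {Z : (x : M) → TangentSpace (𝓡 3) x} (hZ : IsHorizontalNear (g t) (U t) Z x) :
        metricIn g φ (t, φ x) (fieldIn U φ (t, φ x)) (pushField φ Z (φ x)) = 0 :=
      (inner_eq_metricIn hφ t (U t) Z hx).symm.trans hZ.2.self_of_nhds
    have hsymm := (isLocalFlow_chart htriple hflow hφ).symm (t, φ x)
    refine ⟨⟨2 * a, fun X Y hX hY => ?_⟩, fun X Y hX hY => ?_⟩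
    · rw [lieDerivMetric_eq_shape htriple hflow hφ ht hx hX hY, inner_eq_metricIn hφ t _ _ hx,
        ha _ _ (horth hX) (horth hY), ha _ _ (horth hY) (horth hX), hsymm (pushField φ Y (φ x))]
      ring
    · rw [inner_mlieBracket_eq_shape htriple hflow hφ ht hx hX hY,
        ha _ _ (horth hX) (horth hY), ha _ _ (horth hY) (horth hX), hsymm (pushField φ Y (φ x))]
      ring

end Smooth

/-! ### Integral curves of `∂_t + U` -/

/-- Derivatives are taken within S so that closed intervals, with one-sided derivatives at their
ends, are covered. -/
theorem hasDerivWithinAt_chart (hφ : φ ∈ IsManifold.maximalAtlas (𝓡 3) ∞ M) {γ : ℝ → ℝ × M}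
    {S : Set ℝ} (hγ : IsMIntegralCurveOn (I := 𝓘(ℝ, ℝ).prod (𝓡 3)) γ (nullField U) S) {s : ℝ}
    (hs : s ∈ S) (hx : (γ s).2 ∈ φ.source) :
    HasDerivWithinAt (fun r => ((γ r).1, φ (γ r).2))
      (1, fieldIn U φ ((γ s).1, φ (γ s).2)) S s := by
  have h := hγ s hs
  let L : ℝ →L[ℝ] ℝ × E3 := ContinuousLinearMap.smulRight (1 : ℝ →L[ℝ] ℝ) (1, U (γ s).1 (γ s).2)
  let D : E3 →L[ℝ] E3 := mfderiv (𝓡 3) (𝓡 3) φ (γ s).2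
  have h1 : HasFDerivWithinAt (fun r => (γ r).1) ((ContinuousLinearMap.fst ℝ ℝ E3).comp L) S s :=
    ((hasMFDerivAt_fst (γ s)).comp_hasMFDerivWithinAt s h).hasFDerivWithinAt
  have h2 : HasFDerivWithinAt (fun r => φ (γ r).2)
      (D.comp ((ContinuousLinearMap.snd ℝ ℝ E3).comp L)) S s :=
    (((mdifferentiable_of_mem_maximalAtlas hφ).mdifferentiableAt hx).hasMFDerivAt
      |>.comp_hasMFDerivWithinAt s
        ((hasMFDerivAt_snd (γ s)).comp_hasMFDerivWithinAt s h)).hasFDerivWithinAt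
  have h3 : fieldIn U φ ((γ s).1, φ (γ s).2) = D (U (γ s).1 (γ s).2) :=
    pushField_apply (U (γ s).1) hx
  have h4 := (h1.prodMk h2).hasDerivWithinAt
  simpa [L, h3] using h4

end NullFlow

/-! ### Null geodesics, and the continuity argument along integral curves. -/

namespace NullFlow

/-- Integral curves of `∂_t + u` satisfy the geodesic equation. -/
theorem IsFlowAt.geodesic_eq {g : ℝ × E3 → E3 →L[ℝ] E3 →L[ℝ] ℝ} {u : ℝ × E3 → E3} {p : ℝ × E3}
    (hf : IsFlowAt g u p) :
    (0, fderiv ℝ u p (1, u p)) + christoffel (spacetime g) p (1, u p) (1, u p) = 0 := by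
  have hg := hf.differentiableAt_metric
  have hW : ((1 : ℝ), u p) = (1, 0) + (0, u p) := by simp
  apply injective_of_isInvertible (isInvertible_spacetime hf.inv)
  intro z
  have hz : z = z.1 • (1, 0) + (0, z.2) := by ext <;> simp
  -- Since h(u, ·) = 0, the time derivatives of g drop out of the symbol Γ((1, u), (1, u)), which
  -- reduces to that of the slice.
  have h1 : fderiv ℝ g p (1, u p) (u p) z.2 = fderiv ℝ g p (0, u p) (u p) z.2 := by
    rw [hW, map_add, add_apply, add_apply, hf.metric_eq, zero_add]
  have h2 : fderiv ℝ g p z (u p) (u p) = fderiv ℝ g p (0, z.2) (u p) (u p) := by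
    conv_lhs => rw [hz]
    rw [map_add, add_apply, add_apply, map_smul, smul_apply, smul_apply, hf.metric_eq, smul_zero,
      zero_add]
  have h3 : fderiv ℝ u p (1, u p) = - sliceChristoffel g p (u p) (u p) :=
    eq_neg_of_add_eq_zero_left hf.flowDeriv_field
  rw [map_add, add_apply, apply_christoffel_spacetime hf.smooth_metric hf.inv, spacetime_apply, h1,
    h2, h3, map_neg, neg_apply, apply_sliceChristoffel hg hf.inv, map_zero, zero_apply]
  ring

variable {M : Type*} [TopologicalSpace M] [ChartedSpace E3 M] {φ : OpenPartialHomeomorph M E3}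
  {I : Set ℝ} {g : ℝ → Bundle.RiemannianMetric (fun x : M => TangentSpace (𝓡 3) x)}
  {U : ℝ → (x : M) → TangentSpace (𝓡 3) x} {γ : ℝ → ℝ × M}

theorem continuousOn_of_isMIntegralCurveOn {S : Set ℝ}
    (hγ : IsMIntegralCurveOn (I := 𝓘(ℝ, ℝ).prod (𝓡 3)) γ (nullField U) S) : ContinuousOn γ S :=
  fun s hs => (hγ s hs).continuousWithinAt

theorem isNullGeodesicOn (htriple : IsEvolvingTriple I g U) (hflow : IsModifiedRicciFlow I g U)
    {J : Set ℝ} (hJ : IsOpen J)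
    (hγ : IsMIntegralCurveOn (I := 𝓘(ℝ, ℝ).prod (𝓡 3)) γ (nullField U) J)
    (hν : ∀ s ∈ J, (γ s).1 ∈ I ∧ NuNeZero g U (γ s).1 (γ s).2) : IsNullGeodesicOn g γ J := by
  have hcont := continuousOn_of_isMIntegralCurveOn hγ
  refine ⟨hcont, fun φ hφ s hs hx => ?_⟩
  intro c
  have hL := isLocalFlow_chart htriple hflow hφ
  set V : Set ℝ := J ∩ (fun r => (γ r).2) ⁻¹' φ.source with hV
  have hVo : IsOpen V := (continuous_snd.comp_continuousOn hcont).isOpen_inter_preimage hJ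
    φ.open_source
  have hsV : s ∈ V := ⟨hs, hx⟩
  have hd : ∀ r ∈ V, HasDerivAt c (1, fieldIn U φ (c r)) r := fun r hr =>
    (hasDerivWithinAt_chart hφ hγ hr.1 hr.2).hasDerivAt (hJ.mem_nhds hr.1)
  have hdiff : DifferentiableOn ℝ c V := fun r hr =>
    (hd r hr).differentiableAt.differentiableWithinAt
  have hderiv : EqOn (deriv c) (fun r => (1, fieldIn U φ (c r))) V := fun r hr => (hd r hr).deriv
  have hu : ∀ r ∈ V, ContDiffAt ℝ 2 (fieldIn U φ) (c r) := fun r hr =>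
    hL.smooth_field _ (hν r hr.1).1 _ (φ.map_source hr.2)
  -- Bootstrap: c' = (1, u(c)) is continuous, so c is C¹; then c' is C¹, so c is C².
  have h1 : ContDiffOn ℝ 1 c V := by
    rw [show (1 : WithTop ℕ∞) = 0 + 1 by norm_num, contDiffOn_succ_iff_deriv_of_isOpen hVo]
    refine ⟨hdiff, by simp, contDiffOn_zero.2 (ContinuousOn.congr ?_ hderiv)⟩
    exact continuousOn_const.prodMk fun r hr =>
      ((hu r hr).continuousAt.comp (hd r hr).continuousAt).continuousWithinAt
  have h2 : ContDiffOn ℝ 2 c V := by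
    rw [show (2 : WithTop ℕ∞) = 1 + 1 by norm_num, contDiffOn_succ_iff_deriv_of_isOpen hVo]
    refine ⟨hdiff, by simp, ContDiffOn.congr ?_ hderiv⟩
    exact contDiffOn_const.prodMk fun r hr =>
      (((hu r hr).of_le (by norm_num)).comp r
        (h1.contDiffAt (hVo.mem_nhds hr))).contDiffWithinAt
  obtain ⟨hI, hne⟩ := hν s hs
  have hunit := hL.unit _ hI _ (φ.map_source hx)
  obtain ⟨X, Y, hF⟩ := exists_isComplementaryFrame (hL.symm (c s))
    (hL.pos _ _ (φ.map_source hx)) hunit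
  have hf : IsFlowAt (metricIn g φ) (fieldIn U φ) (c s) :=
    hL.isFlowAt hI (φ.map_source hx) hF (neg_ne_zero.1 (hne φ hφ hx X Y hF))
  rw [(hd s hsV).deriv]
  refine ⟨h2.contDiffAt (hVo.mem_nhds hsV), ?_, ?_, ?_⟩
  · have h3 : HasDerivAt (fun r => ((1 : ℝ), fieldIn U φ (c r)))
        (0, fderiv ℝ (fieldIn U φ) (c s) (1, fieldIn U φ (c s))) s :=
      (hasDerivAt_const s (1 : ℝ)).prodMk
        (hf.differentiableAt_field.hasFDerivAt.comp_hasDerivAt s (hd s hsV))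
    have h4 : deriv c =ᶠ[𝓝 s] fun r => (1, fieldIn U φ (c r)) :=
      hderiv.eventuallyEq_of_mem (hVo.mem_nhds hsV)
    rw [h4.deriv_eq, h3.deriv]
    exact hf.geodesic_eq
  · rw [spacetime_apply]
    simp only [mul_one]
    exact sub_eq_zero.2 hunit
  · intro h
    exact one_ne_zero (congrArg Prod.fst h)

/-- The time component of ∂_t + U is 1, so the curve parameter is the time. -/
theorem fst_integralCurve {t : ℝ} [IsManifold (𝓡 3) ∞ M]
    (hγ : IsMIntegralCurveOn (I := 𝓘(ℝ, ℝ).prod (𝓡 3)) γ (nullField U) (Icc 0 t))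
    (h0 : (γ 0).1 = 0) : ∀ s ∈ Icc 0 t, (γ s).1 = s := by
  have hd : ∀ s ∈ Icc 0 t, HasDerivWithinAt (fun r => (γ r).1 - r) 0 (Icc 0 t) s := by
    intro s hs
    have h1 := hasDerivWithinAt_chart (U := U)
      (IsManifold.chart_mem_maximalAtlas (I := 𝓡 3) (n := ∞) (γ s).2) hγ hs
      (mem_chart_source E3 (γ s).2)
    have h2 : HasDerivWithinAt (fun r => (γ r).1) 1 (Icc 0 t) s :=
      (ContinuousLinearMap.fst ℝ ℝ E3).hasFDerivAt.comp_hasDerivWithinAt s h1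
    simpa using h2.fun_sub (hasDerivWithinAt_id s (Icc 0 t))
  have hc := constant_of_has_deriv_right_zero (f := fun r => (γ r).1 - r) (a := 0) (b := t)
    (fun s hs => (hd s hs).continuousWithinAt) fun s hs =>
      (hd s (Ico_subset_Icc_self hs)).mono_of_mem_nhdsWithin
        (Icc_mem_nhdsGE_of_mem hs)
  intro s hs
  have := hc s hs
  simp only [h0, sub_zero] at this
  linarith

/-- Conformality of the foliation and integrability of its complement persist along the integral
curves of `∂_t + U`. -/
theorem isConformalIntegrableAt_of_integralCurve [IsManifold (𝓡 3) ∞ M] (hI : I.OrdConnected)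
    (h0I : (0 : ℝ) ∈ I) (htriple : IsEvolvingTriple I g U) (hflow : IsModifiedRicciFlow I g U)
    {t : ℝ} (ht : t ∈ I) (ht0 : 0 ≤ t)
    (hρ : ∀ s ∈ Icc 0 t, ∀ x : M, RhoNeZero g U s x)
    (hinit : ∀ x : M, IsConformalIntegrableAt (g 0) (U 0) x)
    (hγ : IsMIntegralCurveOn (I := 𝓘(ℝ, ℝ).prod (𝓡 3)) γ (nullField U) (Icc 0 t))
    (h0 : (γ 0).1 = 0) :
    IsConformalIntegrableAt (g t) (U t) (γ t).2 := by
  have hsub : Icc 0 t ⊆ I := hI.out h0I ht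
  have hfst := fst_integralCurve hγ h0
  have hcont := continuousOn_of_isMIntegralCurveOn hγ
  have hiff {φ : OpenPartialHomeomorph M E3} (hφ : φ ∈ IsManifold.maximalAtlas (𝓡 3) ∞ M) {s : ℝ}
      (hs : s ∈ Icc 0 t) (hx : (γ s).2 ∈ φ.source) :
      IsConformalIntegrableAt (g s) (U s) (γ s).2
        ↔ IsUmbilicAt (metricIn g φ) (fieldIn U φ) ((γ s).1, φ (γ s).2) := by
    rw [hfst s hs]
    exact isConformalIntegrableAt_iff htriple hflow hφ (hsub hs) hx
  have hall : Icc 0 t ⊆ {s | IsConformalIntegrableAt (g s) (U s) (γ s).2} := by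
    -- Continuous induction on [0, t]: the good times form a closed set containing 0 and open to the
    -- right.
    refine IsClosed.Icc_subset_of_forall_mem_nhdsWithin ?_ (hinit _) ?_
    · refine isClosed_of_closure_subset fun s hs => ?_
      have hsI : s ∈ Icc 0 t :=
        isClosed_Icc.closure_subset_iff.2 inter_subset_right hs
      refine ⟨?_, hsI⟩
      set φ := chartAt E3 (γ s).2
      have hφ := IsManifold.chart_mem_maximalAtlas (I := 𝓡 3) (n := ∞) (γ s).2
      have hx := mem_chart_source E3 (γ s).2
      have hne := mem_closure_iff_nhdsWithin_neBot.1 hs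
      have hL := isLocalFlow_chart htriple hflow hφ
      have hγs := (hcont s hsI).mono (inter_subset_right :
        {s | IsConformalIntegrableAt (g s) (U s) (γ s).2} ∩ Icc 0 t ⊆ Icc 0 t)
      have hsrc : ∀ᶠ r in 𝓝[{s | IsConformalIntegrableAt (g s) (U s) (γ s).2} ∩ Icc 0 t] s,
          (γ r).2 ∈ φ.source :=
        (continuousAt_snd.comp_continuousWithinAt hγs).eventually (φ.open_source.mem_nhds hx)
      refine (hiff hφ hsI hx).2 (hL.isUmbilicAt_of_tendsto (c := fun r => ((γ r).1, φ (γ r).2))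
        (by rw [hfst s hsI]; exact hsub hsI) (φ.map_source hx)
        (l := 𝓝[{s | IsConformalIntegrableAt (g s) (U s) (γ s).2} ∩ Icc 0 t] s) ?_ ?_ ?_)
      · have hc₁ : ContinuousWithinAt (fun r => (γ r).1)
            ({s | IsConformalIntegrableAt (g s) (U s) (γ s).2} ∩ Icc 0 t) s :=
          continuousAt_fst.comp_continuousWithinAt hγs
        have hc₂ : ContinuousWithinAt (fun r => (γ r).2)
            ({s | IsConformalIntegrableAt (g s) (U s) (γ s).2} ∩ Icc 0 t) s :=
          continuousAt_snd.comp_continuousWithinAt hγs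
        exact hc₁.prodMk (ContinuousAt.comp_continuousWithinAt (f := fun r => (γ r).2)
          (φ.continuousAt hx) hc₂)
      · filter_upwards [self_mem_nhdsWithin] with r hr
        rw [hfst r hr.2]
        exact hsub hr.2
      · filter_upwards [self_mem_nhdsWithin, hsrc] with r hr hr'
        exact (hiff hφ hr.2 hr').1 hr.1
    · rintro s ⟨hs, hst⟩
      have hsI : s ∈ Icc 0 t := Ico_subset_Icc_self hst
      set φ := chartAt E3 (γ s).2
      have hφ := IsManifold.chart_mem_maximalAtlas (I := 𝓡 3) (n := ∞) (γ s).2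
      have hx := mem_chart_source E3 (γ s).2
      have hL := isLocalFlow_chart htriple hflow hφ
      have hγs : ContinuousWithinAt γ (Ici s) s :=
        (hcont s hsI).mono_of_mem_nhdsWithin (Icc_mem_nhdsGE_of_mem hst)
      have hev : ∀ᶠ r in 𝓝[≥] s, r ∈ Icc 0 t ∧ (γ r).2 ∈ φ.source :=
        (Filter.eventually_of_mem (Icc_mem_nhdsGE_of_mem hst) fun r hr => hr).and
          ((continuousAt_snd.comp_continuousWithinAt hγs).eventually (φ.open_source.mem_nhds hx))
      obtain ⟨b, hb, hb'⟩ := mem_nhdsGE_iff_exists_Icc_subset.1 hev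
      have hum := (hiff hφ hsI hx).1 hs
      have hsI' : (γ s).1 ∈ I := by rw [hfst s hsI]; exact hsub hsI
      have hunit := hL.unit _ hsI' _ (φ.map_source hx)
      obtain ⟨X, Y, hF⟩ := exists_isComplementaryFrame (hL.symm ((γ s).1, φ (γ s).2))
        (hL.pos _ _ (φ.map_source hx)) hunit
      have hρs : RhoNeZero g U (γ s).1 (γ s).2 := by
        rw [hfst s hsI]
        exact hρ s hsI (γ s).2
      have hrho := hρs φ hφ hx X Y hF
      -- At an umbilic point the imaginary part of ρ, an antisymmetric component of `shape`,
      -- vanishes, and the real part is the trace; so ρ ≠ 0 forces the trace to be non-zero.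
      have hν : shape (metricIn g φ) (fieldIn U φ) ((γ s).1, φ (γ s).2) X X
          + shape (metricIn g φ) (fieldIn U φ) ((γ s).1, φ (γ s).2) Y Y ≠ 0 := by
        intro h1
        apply hrho
        obtain ⟨a, ha⟩ := hum
        have h2 : shape (metricIn g φ) (fieldIn U φ) ((γ s).1, φ (γ s).2) Y X
            - shape (metricIn g φ) (fieldIn U φ) ((γ s).1, φ (γ s).2) X Y = 0 := by
          rw [ha _ _ hF.orth_uY hF.orth_uX, ha _ _ hF.orth_uX hF.orth_uY, hL.symm _ Y X, sub_self]
        rw [rho]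
        change ((shape (metricIn g φ) (fieldIn U φ) ((γ s).1, φ (γ s).2) X X
          + shape (metricIn g φ) (fieldIn U φ) ((γ s).1, φ (γ s).2) Y Y : ℝ) : ℂ)
          + ((shape (metricIn g φ) (fieldIn U φ) ((γ s).1, φ (γ s).2) Y X
            - shape (metricIn g φ) (fieldIn U φ) ((γ s).1, φ (γ s).2) X Y : ℝ) : ℂ) * Complex.I = 0
        rw [h1, h2]
        simp
      have hd : ∀ r ∈ Icc s b, HasDerivWithinAt (fun r => ((γ r).1, φ (γ r).2))
          (1, fieldIn U φ ((γ r).1, φ (γ r).2)) (Icc 0 t) r := fun r hr =>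
        hasDerivWithinAt_chart hφ hγ (hb' hr).1 (hb' hr).2
      have hbt : b ≤ t := (hb' (right_mem_Icc.2 (le_of_lt hb))).1.2
      have hres := hL.eventually_isUmbilicAt (c := fun r => ((γ r).1, φ (γ r).2)) hb
        (fun r hr => (hd r hr).continuousWithinAt.mono fun q hq => (hb' hq).1)
        (fun r hr => by rw [hfst r (hb' hr).1]; exact hsub (hb' hr).1)
        (fun r hr => φ.map_source (hb' hr).2)
        (fun r hr => (hd r (Ico_subset_Icc_self hr)).mono_of_mem_nhdsWithin
          (Icc_mem_nhdsGE_of_mem ⟨hst.1.trans hr.1, hr.2.trans_le hbt⟩))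
        hum hF hν
      filter_upwards [hres, Ioc_mem_nhdsGT hb] with r hr hr'
      have hr'' := hb' (Ioc_subset_Icc_self hr')
      exact (hiff hφ hr''.1 hr''.2).2 hr
  exact hall (right_mem_Icc.2 ht0)

end NullFlow

end

/-! ### The main theorem. -/

theorem mainTheorem3 {M : Type*} [TopologicalSpace M] [T2Space M] [SecondCountableTopology M]
    [ChartedSpace NullFlow.E3 M] [IsManifold (𝓡 3) ∞ M]
    (I : Set ℝ) (hI : I.OrdConnected) (h0 : (0 : ℝ) ∈ I)
    (g : ℝ → Bundle.RiemannianMetric (fun x : M => TangentSpace (𝓡 3) x))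
    (U : ℝ → (x : M) → TangentSpace (𝓡 3) x)
    (htriple : NullFlow.IsEvolvingTriple I g U)
    (hflow : NullFlow.IsModifiedRicciFlow I g U) :
    -- persistence, given the two properties at the initial time
    (NullFlow.IsConformalFoliationOn (g 0) (U 0) univ →
      NullFlow.IsIntegrableComplementOn (g 0) (U 0) univ →
      ∀ t ∈ I, 0 ≤ t → (∀ s ∈ Icc 0 t, ∀ x : M, NullFlow.RhoNeZero g U s x) →
        NullFlow.IsConformalFoliationOn (g t) (U t) (NullFlow.reached U t) ∧
        NullFlow.IsIntegrableComplementOn (g t) (U t) (NullFlow.reached U t)) ∧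
    -- the integral curves of `∂_t + U` are null geodesics
    (∀ J : Set ℝ, IsOpen J → ∀ γ : ℝ → ℝ × M,
      IsMIntegralCurveOn (I := 𝓘(ℝ, ℝ).prod (𝓡 3)) γ (NullFlow.nullField U) J →
      (∀ s ∈ J, (γ s).1 ∈ I ∧ NullFlow.NuNeZero g U (γ s).1 (γ s).2) →
      NullFlow.IsNullGeodesicOn g γ J) := by
  refine ⟨fun hconf hint t ht ht0 hρ => ?_,
    fun J hJ γ hγ hν => NullFlow.isNullGeodesicOn htriple hflow hJ hγ hν⟩
  have hinit : ∀ x : M, NullFlow.IsConformalIntegrableAt (g 0) (U 0) x := by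
    obtain ⟨a, ha⟩ := hconf
    exact fun x => ⟨⟨a x, ha x (mem_univ x)⟩, hint x (mem_univ x)⟩
  have key : ∀ x ∈ NullFlow.reached U t, NullFlow.IsConformalIntegrableAt (g t) (U t) x := by
    rintro x ⟨γ, hγ, hγ0, hγt⟩
    have h := NullFlow.isConformalIntegrableAt_of_integralCurve hI h0 htriple hflow ht ht0 hρ hinit
      hγ hγ0
    rwa [hγt] at h
  -- No regularity is asked of the conformal factor, so it is chosen point by point.
  choose! a ha using fun x hx => (key x hx).1
  exact ⟨⟨a, ha⟩, fun x hx => (key x hx).2⟩
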